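/- Let $n \ge 1$ and let $H^2(\mathbb{D}^n)$ be the Hardy space of all analytic functions $f$ on the unit polydisc $\mathbb{D}^n$ with $\|f\| = \sup_{0 \le r < 1} \big( \int_{\mathbb{T}^n} |f(r\boldsymbol z)|^2 \, d\mu(\boldsymbol z) \big)^{1/2} < \infty$, where $\mu$ is the normalized Lebesgue measure on $\mathbb{T}^n$. Let $\mathcal{S} \ne \{0\}$ be a submodule of $H^2(\mathbb{D}^n)$, that is, a closed subspace with $z_j \mathcal{S} \subseteq \mathcal{S}$ for all $j \in \{1,\dots,n\}$, and let $P_{\mathcal{S}}$ be the orthogonal projection of $H^2(\mathbb{D}^n)$ onto $\mathcal{S}$. For $j \in \{1,\dots,n\}$ let $R_{z_j} : \mathcal{S} \to \mathcal{S}$, $R_{z_j} f = z_j f$, and let $E_{z_j} : H^2(\mathbb{D}^n) \to \mathcal{S}$, $E_{z_j} = P_{\mathcal{S}} \circ ev_{z_j}$, where $(ev_{z_j} f)(z_1,\dots,z_n) = f(z_1,\dots,z_{j-1},0,z_{j+1},\dots,z_n)$. An inner function is a bounded analytic function on $\mathbb{D}^n$ whose radial boundary values have modulus $1$ almost everywhere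 on $\mathbb{T}^n$. Fix $i \in \{1,\dots,n\}$. Then $\mathcal{S} = \theta(z_i) H^2(\mathbb{D}^n)$ for some inner function $\theta(z_i)$ on $\mathbb{D}^n$ depending only on the variable $z_i$ if and only if \[ (I_{\mathcal{S}} - E_{z_j} E_{z_j}^*)(I_{\mathcal{S}} - R_{z_j} R_{z_j}^*) = 0 \qquad \text{for all } j \in \{1,\dots,n\} \setminus \{i\}. \] -/

import Mathlib

open MeasureTheory Filter Topology

noncomputable section

namespace PolydiscHardy

/-- The open unit polydisc. -/
def polydisc (n : ℕ) : Set (Fin n → ℂ) := {z | ∀ i, ‖z i‖ < 1}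

/-- The point of the distinguished boundary with angular coordinates `t`. -/
def torusPoint {n : ℕ} (t : UnitAddTorus (Fin n)) : Fin n → ℂ := fun i => ((t i).toCircle : ℂ)

/-- Normalized Lebesgue (Haar) measure on the torus. -/
def torusMeasure (n : ℕ) : Measure (UnitAddTorus (Fin n)) :=
  Measure.pi fun _ => AddCircle.haarAddCircle

/-- The `L²` integral mean of `f` over the torus of radius `r`. -/
def integralMean {n : ℕ} (f : (Fin n → ℂ) → ℂ) (r : ℝ) : ℝ :=
  √(∫ t, ‖f ((r : ℂ) • torusPoint t)‖ ^ 2 ∂torusMeasure n)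

/-- The monomial `z ^ α`. -/
def mon {n : ℕ} (z : Fin n → ℂ) (α : Fin n → ℕ) : ℂ := ∏ i, z i ^ α i

theorem polydisc_eq_ball (n : ℕ) : polydisc n = Metric.ball 0 1 := by
  ext z
  simp [polydisc, pi_norm_lt_iff]

theorem isOpen_polydisc (n : ℕ) : IsOpen (polydisc n) := by
  rw [polydisc_eq_ball]; exact Metric.isOpen_ball

theorem norm_torusPoint_apply {n : ℕ} (t : UnitAddTorus (Fin n)) (i : Fin n) :
    ‖torusPoint t i‖ = 1 :=
  Circle.norm_coe _

theorem smul_torusPoint_mem {n : ℕ} {r : ℝ} (h0 : 0 ≤ r) (h1 : r < 1)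
    (t : UnitAddTorus (Fin n)) : (r : ℂ) • torusPoint t ∈ polydisc n := by
  intro i
  simp [norm_torusPoint_apply, abs_of_nonneg h0, h1]

theorem mon_smul {n : ℕ} (c : ℂ) (z : Fin n → ℂ) (α : Fin n → ℕ) :
    mon (c • z) α = c ^ (∑ i, α i) * mon z α := by
  simp [mon, mul_pow, Finset.prod_mul_distrib, Finset.prod_pow_eq_pow_sum]

theorem norm_mon {n : ℕ} (z : Fin n → ℂ) (α : Fin n → ℕ) :
    ‖mon z α‖ = ∏ i, ‖z i‖ ^ α i := by
  simp [mon]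

theorem mon_torusPoint {n : ℕ} (t : UnitAddTorus (Fin n)) (α : Fin n → ℕ) :
    mon (torusPoint t) α = UnitAddTorus.mFourier (fun i => (α i : ℤ)) t := by
  simp [mon, torusPoint, UnitAddTorus.mFourier, fourier_apply, AddCircle.toCircle_nsmul]

theorem norm_mon_torusPoint {n : ℕ} (t : UnitAddTorus (Fin n)) (α : Fin n → ℕ) :
    ‖mon (torusPoint t) α‖ = 1 := by
  simp [norm_mon, norm_torusPoint_apply]

/-- Fourier coefficients and Parseval identity for an absolutely convergent series. -/
theorem parseval {n : ℕ} {b : (Fin n → ℕ) → ℂ} (hb : Summable b)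
    {g : UnitAddTorus (Fin n) → ℂ} (hg : ∀ t, HasSum (fun α => b α * mon (torusPoint t) α) (g t)) :
    (∀ α, ∫ t, (starRingEnd ℂ) (mon (torusPoint t) α) * g t ∂torusMeasure n = b α) ∧
    HasSum (fun α => ‖b α‖ ^ 2) (∫ t, ‖g t‖ ^ 2 ∂torusMeasure n) := by
  let ms : MeasureSpace UnitAddCircle := ⟨AddCircle.haarAddCircle⟩
  have : IsProbabilityMeasure (volume : Measure UnitAddCircle) :=
    inferInstanceAs (IsProbabilityMeasure AddCircle.haarAddCircle)
  let e : (Fin n → ℕ) → C(UnitAddTorus (Fin n), ℂ) :=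
    fun α => UnitAddTorus.mFourier (fun i => (α i : ℤ))
  have hs : Summable fun α => b α • e α := by
    apply Summable.of_norm
    simpa [e, norm_smul, UnitAddTorus.mFourier_norm] using hb.norm
  obtain ⟨G, hG⟩ := hs
  have hGg : ∀ t, G t = g t := by
    intro t
    have h1 := (ContinuousMap.evalCLM ℂ t).hasSum hG
    refine h1.unique ?_
    simpa [Function.comp_def, e, mon_torusPoint] using hg t
  have hgG : g = G := funext fun t => (hGg t).symm
  let T := ContinuousMap.toLp (E := ℂ) 2 (volume : Measure (UnitAddTorus (Fin n))) ℂ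
  have hT : HasSum (fun α => b α • T (e α)) (T G) := by
    simpa [Function.comp_def] using T.hasSum hG
  have ho : Orthonormal ℂ (fun α => T (e α)) :=
    (UnitAddTorus.orthonormal_mFourier (d := Fin n)).comp (fun α : Fin n → ℕ => fun i => (α i : ℤ))
      (fun α β h => by ext i; have := congrFun h i; simpa using this)
  have hin : ∀ α, inner ℂ (T (e α)) (T G) = b α := by
    intro α
    have h1 := (innerSL ℂ (T (e α))).hasSum hT
    refine h1.unique ?_
    have : (fun β => (innerSL ℂ (T (e α))) (b β • T (e β))) = fun β => if β = α then b α else 0 := by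
      funext β
      simp only [innerSL_apply_apply, inner_smul_right, orthonormal_iff_ite.1 ho]
      rcases eq_or_ne α β with h | h
      · subst h; simp
      · simp [h, h.symm]
    simp only [this]
    exact hasSum_ite_eq α (b α)
  constructor
  · intro α
    have := hin α
    simp only [T] at this
    rw [ContinuousMap.inner_toLp] at this
    rw [← this, hgG]
    refine integral_congr_ae (Eventually.of_forall fun t => ?_)
    simp [e, mon_torusPoint, mul_comm]
  · have h1 := (innerSL ℂ (T G)).hasSum hT
    have h2 : (fun β => (innerSL ℂ (T G)) (b β • T (e β))) = fun β => ((‖b β‖ ^ 2 : ℝ) : ℂ) := by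
      funext β
      rw [innerSL_apply_apply, inner_smul_right, ← inner_conj_symm, hin, RCLike.mul_conj]
      simp
    simp only [h2] at h1
    have h3 : (innerSL ℂ (T G)) (T G) = ((∫ t, ‖g t‖ ^ 2 ∂torusMeasure n : ℝ) : ℂ) := by
      rw [innerSL_apply_apply]
      simp only [T]
      rw [ContinuousMap.inner_toLp, ← integral_complex_ofReal, hgG]
      refine integral_congr_ae (Eventually.of_forall fun t => ?_)
      simp [RCLike.mul_conj]
    rw [h3] at h1
    exact Complex.hasSum_ofReal.1 h1

theorem summable_pi_prod : ∀ {n : ℕ} {c : Fin n → ℕ → ℝ}, (∀ i k, 0 ≤ c i k) →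
    (∀ i, Summable (c i)) → Summable fun α : Fin n → ℕ => ∏ i, c i (α i)
  | 0, c, _, _ => by
    exact (hasSum_fintype _).summable
  | n + 1, c, h0, hs => by
    have ih := summable_pi_prod (fun i k => h0 (Fin.succ i) k) (fun i => hs (Fin.succ i))
    have h := (hs 0).mul_of_nonneg ih (fun k => h0 0 k)
      (fun α => Finset.prod_nonneg fun i _ => h0 _ _)
    rw [← (Fin.consEquiv (fun _ : Fin (n + 1) => ℕ)).summable_iff]
    refine h.congr fun x => ?_
    simp [Fin.prod_univ_succ, Fin.consEquiv]

/-- A power series with bounded coefficients on each smaller polydisc converges. -/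
theorem summable_of_bound {n : ℕ} {a : (Fin n → ℕ) → ℂ}
    (h : ∀ r : ℝ, 0 < r → r < 1 → ∃ C, ∀ α, ‖a α‖ * r ^ (∑ i, α i) ≤ C)
    {z : Fin n → ℂ} (hz : z ∈ polydisc n) : Summable fun α => a α * mon z α := by
  obtain ⟨r, hr0, hr1, hr⟩ : ∃ r : ℝ, 0 < r ∧ r < 1 ∧ ∀ i, ‖z i‖ < r := by
    have hz' : ‖z‖ < 1 := (pi_norm_lt_iff one_pos).2 hz
    obtain ⟨r, h1, h2⟩ := exists_between hz'
    exact ⟨r, (norm_nonneg _).trans_lt h1, h2, fun i => (norm_le_pi_norm z i).trans_lt h1⟩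
  obtain ⟨C, hC⟩ := h r hr0 hr1
  have hs : Summable fun α : Fin n → ℕ => ∏ i, (‖z i‖ / r) ^ α i :=
    summable_pi_prod (c := fun i k => (‖z i‖ / r) ^ k)
      (fun i k => by positivity)
      (fun i => summable_geometric_of_lt_one (by positivity) ((div_lt_one hr0).2 (hr i)))
  refine Summable.of_norm_bounded (hs.mul_left C) fun α => ?_
  have : ∏ i, (‖z i‖ / r) ^ α i = ‖mon z α‖ / r ^ (∑ i, α i) := by
    simp [div_pow, norm_mon, Finset.prod_pow_eq_pow_sum]
  rw [this, norm_mul]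
  calc ‖a α‖ * ‖mon z α‖ = (‖a α‖ * r ^ (∑ i, α i)) * (‖mon z α‖ / r ^ (∑ i, α i)) := by
        field_simp
    _ ≤ _ := mul_le_mul_of_nonneg_right (hC α) (by positivity)

/-- Along each complex line through the origin the power series at `0` converges on the polydisc. -/
theorem hasSum_slice {n : ℕ} {f : (Fin n → ℂ) → ℂ} (hf : AnalyticOnNhd ℂ f (polydisc n))
    {p : FormalMultilinearSeries ℂ (Fin n → ℂ) ℂ} (hp : HasFPowerSeriesAt f p 0)
    {z : Fin n → ℂ} (hz : z ∈ polydisc n) :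
    HasSum (fun m => p m fun _ => z) (f z) ∧
    ∀ C, (∀ c : ℂ, ‖c‖ = 1 → ‖f (c • z)‖ ≤ C) → ∀ m, ‖p m fun _ => z‖ ≤ C := by
  have hz' : ‖z‖ < 1 := (pi_norm_lt_iff one_pos).2 hz
  obtain ⟨R, hR1, hR⟩ : ∃ R : NNReal, 1 < R ∧ R * ‖z‖ < 1 := by
    rcases eq_or_lt_of_le (norm_nonneg z) with h | h
    · exact ⟨2, by norm_num, by simp [← h]⟩
    · obtain ⟨R, h1, h2⟩ := exists_between ((one_lt_inv₀ h).2 hz')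
      refine ⟨⟨R, by linarith⟩, by exact_mod_cast h1, ?_⟩
      have := mul_lt_mul_of_pos_right h2 h
      rwa [inv_mul_cancel₀ h.ne'] at this
  let u : ℂ →L[ℂ] (Fin n → ℂ) := ContinuousLinearMap.toSpanSingleton ℂ z
  have hu : ∀ c, u c = c • z := fun c => by simp [u]
  have hd : DifferentiableOn ℂ (f ∘ u) (Metric.closedBall 0 R) := by
    intro c hc
    have hc' : u c ∈ polydisc n := by
      rw [polydisc_eq_ball, mem_ball_zero_iff, hu, norm_smul]
      refine lt_of_le_of_lt ?_ hR
      exact mul_le_mul_of_nonneg_right (by simpa using hc) (norm_nonneg _)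
    exact ((hf _ hc').differentiableAt.comp c u.differentiableAt).differentiableWithinAt
  have h1 := hd.hasFPowerSeriesOnBall (by exact_mod_cast one_pos.trans hR1)
  have h2 : HasFPowerSeriesAt (f ∘ u) (p.compContinuousLinearMap u) 0 :=
    HasFPowerSeriesAt.compContinuousLinearMap (by simpa using hp)
  have h3 := h1.hasFPowerSeriesAt.eq_formalMultilinearSeries h2
  have h4 : ∀ m, (p.compContinuousLinearMap u m fun _ => (1 : ℂ)) = p m fun _ => z := by
    intro m
    simp only [FormalMultilinearSeries.compContinuousLinearMap_apply]
    congr 1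
    funext i
    simp [hu]
  constructor
  · have h5 := h1.hasSum (y := 1) (by simpa [Metric.mem_eball, edist_zero_right] using hR1)
    rw [h3] at h5
    simpa only [h4, zero_add, Function.comp_apply, hu, one_smul] using h5
  · intro C hC m
    have hd1 : DifferentiableOn ℂ (f ∘ u) (Metric.closedBall 0 (1 : NNReal)) :=
      hd.mono (Metric.closedBall_subset_closedBall (by exact_mod_cast hR1.le))
    have h6 := (hd1.hasFPowerSeriesOnBall one_pos).hasFPowerSeriesAt.eq_formalMultilinearSeries h2
    rw [← h4, ← h6]
    refine ((cauchyPowerSeries (f ∘ u) 0 (1 : NNReal) m).le_opNorm _).trans ?_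
    simp only [norm_one, Finset.prod_const_one, mul_one]
    refine (norm_cauchyPowerSeries_le _ _ _ _).trans ?_
    have h7 : ∫ θ in (0 : ℝ)..2 * Real.pi, ‖(f ∘ u) (circleMap 0 (1 : NNReal) θ)‖ ≤
        2 * Real.pi * C := by
      have h8 : ‖∫ θ in (0 : ℝ)..2 * Real.pi, ‖(f ∘ u) (circleMap 0 (1 : NNReal) θ)‖‖ ≤
          C * |2 * Real.pi - 0| := by
        apply intervalIntegral.norm_integral_le_of_norm_le_const
        intro θ _
        rw [norm_norm, Function.comp_apply, hu]
        exact hC _ (by simp)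
      rw [sub_zero, abs_of_pos Real.two_pi_pos, mul_comm C] at h8
      exact (le_abs_self _).trans h8
    have h9 : 0 < (2 * Real.pi)⁻¹ := inv_pos.2 Real.two_pi_pos
    simp only [NNReal.coe_one, abs_one, inv_one, one_pow, mul_one]
    have := mul_le_mul_of_nonneg_left h7 h9.le
    rwa [inv_mul_cancel_left₀ Real.two_pi_pos.ne'] at this

/-- Homogeneous terms of a power series as polynomials. -/
theorem exists_homogeneous {n : ℕ} (p : FormalMultilinearSeries ℂ (Fin n → ℂ) ℂ) :
    ∃ a : (Fin n → ℕ) → ℂ, ∀ m z, (p m fun _ => z) =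
      ∑ α ∈ Finset.univ.piAntidiag m, a α * mon z α := by
  let cnt : (m : ℕ) → (Fin m → Fin n) → Fin n → ℕ := fun m σ i => (Finset.univ.filter (σ · = i)).card
  let A : (m : ℕ) → (Fin n → ℕ) → ℂ := fun m α =>
    ∑ σ ∈ Finset.univ.filter (fun σ : Fin m → Fin n => cnt m σ = α),
      p m fun k => Pi.single (σ k) (1 : ℂ)
  refine ⟨fun α => A (∑ i, α i) α, fun m z => ?_⟩
  have h1 : (p m fun _ => z) =
      ∑ σ : Fin m → Fin n, (p m fun k => Pi.single (σ k) (1 : ℂ)) * mon z (cnt m σ) := by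
    have hz : (fun _ : Fin m => z) = fun _ => ∑ i, z i • (Pi.single i (1 : ℂ) : Fin n → ℂ) := by
      funext _
      exact pi_eq_sum_univ' z
    conv_lhs => rw [hz]
    rw [(p m).map_sum]
    refine Finset.sum_congr rfl fun σ _ => ?_
    rw [(p m).map_smul_univ, smul_eq_mul, mul_comm]
    congr 1
    rw [mon, ← Finset.prod_fiberwise_of_maps_to (g := σ) (t := Finset.univ) (by simp)]
    refine Finset.prod_congr rfl fun i _ => ?_
    rw [Finset.prod_congr rfl (g := fun _ => z i) (by simp +contextual)]
    simp [cnt]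
  rw [h1, ← Finset.sum_fiberwise_of_maps_to (g := cnt m) (t := Finset.univ.piAntidiag m)]
  · refine Finset.sum_congr rfl fun α hα => ?_
    have hm : ∑ i, α i = m := by simpa using hα
    simp only [hm, A, Finset.sum_mul]
    refine Finset.sum_congr rfl fun σ hσ => ?_
    rw [(Finset.mem_filter.1 hσ).2]
  · intro σ _
    rw [Finset.mem_piAntidiag]
    refine ⟨?_, fun _ _ => Finset.mem_univ _⟩
    have := Finset.card_eq_sum_card_fiberwise (f := σ) (s := Finset.univ) (t := Finset.univ)
      (by simp)
    simpa [cnt] using this.symm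

theorem hasSum_piAntidiag {n : ℕ} (F : (Fin n → ℕ) → ℂ) (m : ℕ) :
    HasSum (fun x : {α : Fin n → ℕ // ∑ i, α i = m} => F x.1)
      (∑ α ∈ Finset.univ.piAntidiag m, F α) := by
  have h := (Finset.univ.piAntidiag m : Finset (Fin n → ℕ)).hasSum F
  let e : {α : Fin n → ℕ // ∑ i, α i = m} ≃ (Finset.univ.piAntidiag m : Finset (Fin n → ℕ)) :=
    Equiv.subtypeEquivRight (by simp)
  exact (e.hasSum_iff (f := F ∘ Subtype.val)).2 h

/-- Every analytic function on the polydisc is the sum of an absolutely convergent power series. -/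
theorem exists_coeff {n : ℕ} {f : (Fin n → ℂ) → ℂ} (hf : AnalyticOnNhd ℂ f (polydisc n)) :
    ∃ a : (Fin n → ℕ) → ℂ, ∀ z ∈ polydisc n, HasSum (fun α => a α * mon z α) (f z) := by
  obtain ⟨p, hp⟩ := hf 0 (by simp [polydisc])
  obtain ⟨a, ha⟩ := exists_homogeneous p
  have hb : ∀ r : ℝ, 0 < r → r < 1 → ∃ C, ∀ α, ‖a α‖ * r ^ (∑ i, α i) ≤ C := by
    intro r hr0 hr1
    have hsub : Metric.closedBall (0 : Fin n → ℂ) r ⊆ polydisc n := by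
      rw [polydisc_eq_ball]; exact Metric.closedBall_subset_ball hr1
    obtain ⟨C, hC⟩ := (isCompact_closedBall (0 : Fin n → ℂ) r).exists_bound_of_continuousOn
      (hf.continuousOn.mono hsub)
    refine ⟨C, fun α => ?_⟩
    set m := ∑ i, α i with hm
    have hP : ∀ t : UnitAddTorus (Fin n), ‖p m fun _ => (r : ℂ) • torusPoint t‖ ≤ C := by
      intro t
      refine (hasSum_slice hf hp (smul_torusPoint_mem hr0.le hr1 t)).2 C (fun c hc => ?_) m
      apply hC
      rw [mem_closedBall_zero_iff, norm_smul, hc, one_mul, pi_norm_le_iff_of_nonneg hr0.le]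
      intro i
      simp [norm_torusPoint_apply, abs_of_pos hr0]
    let b : (Fin n → ℕ) → ℂ := fun β => if β ∈ Finset.univ.piAntidiag m then a β * r ^ m else 0
    have hbz : ∀ β ∉ Finset.univ.piAntidiag m, b β = 0 := fun β hβ => if_neg hβ
    have hg : ∀ t : UnitAddTorus (Fin n), HasSum (fun β => b β * mon (torusPoint t) β)
        (p m fun _ => (r : ℂ) • torusPoint t) := by
      intro t
      have h : (p m fun _ => (r : ℂ) • torusPoint t) =
          ∑ β ∈ Finset.univ.piAntidiag m, b β * mon (torusPoint t) β := by
        rw [ha]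
        refine Finset.sum_congr rfl fun β hβ => ?_
        have : ∑ i, β i = m := by simpa using hβ
        simp only [b, if_pos hβ, mon_smul, this]
        ring
      rw [h]
      exact hasSum_sum_of_ne_finset_zero fun β hβ => by rw [hbz β hβ, zero_mul]
    have h1 := (parseval (summable_of_ne_finset_zero (f := b) hbz) hg).1 α
    have h2 : b α = a α * r ^ m := if_pos (by simp [hm])
    have h3 : ‖a α‖ * r ^ m = ‖b α‖ := by
      rw [h2]; simp [abs_of_pos hr0]
    rw [h3, ← h1]
    have : IsProbabilityMeasure (torusMeasure n) := by unfold torusMeasure; infer_instance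
    have h4 := norm_integral_le_of_norm_le_const (μ := torusMeasure n) (C := C)
      (f := fun t => (starRingEnd ℂ) (mon (torusPoint t) α) * p m fun _ => (r : ℂ) • torusPoint t)
      (Eventually.of_forall fun t => by
        rw [norm_mul, RCLike.norm_conj, norm_mon_torusPoint, one_mul]; exact hP t)
    simpa using h4
  refine ⟨a, fun z hz => ?_⟩
  have hs := summable_of_bound hb hz
  have h1 := ((Equiv.sigmaFiberEquiv fun α : Fin n → ℕ => ∑ i, α i).hasSum_iff.2 hs.hasSum).sigma
    (fun m => hasSum_piAntidiag (fun α => a α * mon z α) m)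
  have h2 := (hasSum_slice hf hp hz).1
  simp only [ha] at h2
  rw [h2.unique h1]
  exact hs.hasSum

/-- The monomial `z ^ α` as a multilinear map. -/
theorem exists_multilinear {n : ℕ} (α : Fin n → ℕ) :
    ∃ L : ContinuousMultilinearMap ℂ (fun _ : Fin (∑ i, α i) => (Fin n → ℂ)) ℂ,
      ‖L‖ ≤ 1 ∧ ∀ z, (L fun _ => z) = mon z α := by
  let L := (ContinuousMultilinearMap.mkPiAlgebra ℂ (Fin (∑ i, α i)) ℂ).compContinuousLinearMap
    (fun k => ContinuousLinearMap.proj (R := ℂ) (φ := fun _ : Fin n => ℂ)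
      (finSigmaFinEquiv.symm k).1)
  refine ⟨L, ?_, fun z => ?_⟩
  · refine ContinuousMultilinearMap.opNorm_le_bound zero_le_one fun v => ?_
    simp only [L, ContinuousMultilinearMap.compContinuousLinearMap_apply,
      ContinuousMultilinearMap.mkPiAlgebra_apply, norm_prod, one_mul]
    exact Finset.prod_le_prod (fun _ _ => norm_nonneg _) fun k _ => norm_le_pi_norm (v k) _
  · simp only [L, ContinuousMultilinearMap.compContinuousLinearMap_apply,
      ContinuousMultilinearMap.mkPiAlgebra_apply, ContinuousLinearMap.proj_apply]
    rw [Equiv.prod_comp finSigmaFinEquiv.symm (fun x => z x.1), Fintype.prod_sigma]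
    simp [mon]

/-- The sum of a power series converging on the polydisc is analytic there. -/
theorem analyticOnNhd_of_hasSum {n : ℕ} {f : (Fin n → ℂ) → ℂ} {a : (Fin n → ℕ) → ℂ}
    (h : ∀ z ∈ polydisc n, HasSum (fun α => a α * mon z α) (f z)) :
    AnalyticOnNhd ℂ f (polydisc n) := by
  choose L hL1 hL2 using fun α : Fin n → ℕ => exists_multilinear α
  let M : (m : ℕ) → (Fin n → ℕ) → ContinuousMultilinearMap ℂ (fun _ : Fin m => (Fin n → ℂ)) ℂ :=
    fun m α => if hm : ∑ i, α i = m then hm ▸ L α else 0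
  have hM1 : ∀ m α, ‖M m α‖ ≤ 1 := by
    intro m α
    by_cases hm : ∑ i, α i = m
    · subst hm; simpa [M] using hL1 α
    · simp [M, hm]
  have hM2 : ∀ m α z, ∑ i, α i = m → (M m α fun _ => z) = mon z α := by
    intro m α z hm
    subst hm; simpa [M] using hL2 α z
  let p : FormalMultilinearSeries ℂ (Fin n → ℂ) ℂ := fun m =>
    ∑ α ∈ Finset.univ.piAntidiag m, a α • M m α
  have hp : ∀ m z, (p m fun _ => z) = ∑ α ∈ Finset.univ.piAntidiag m, a α * mon z α := by
    intro m z
    simp only [p, _root_.sum_apply, _root_.smul_apply,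
      smul_eq_mul]
    exact Finset.sum_congr rfl fun α hα => by rw [hM2 m α z (by simpa using hα)]
  have hb : HasFPowerSeriesOnBall f p 0 1 := by
    refine ⟨?_, one_pos, ?_⟩
    · refine ENNReal.le_of_forall_nnreal_lt fun r hr => ?_
      have hr1 : (r : ℝ) < 1 := by exact_mod_cast hr
      have hs : Summable fun α : Fin n → ℕ => ‖a α‖ * (r : ℝ) ^ (∑ i, α i) := by
        have h0 := (h (fun _ => ((r : ℝ) : ℂ)) (fun i => by simpa using hr1)).summable.norm
        refine h0.congr fun α => ?_
        simp [mon, Finset.prod_pow_eq_pow_sum]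
      refine p.le_radius_of_bound (∑' α : Fin n → ℕ, ‖a α‖ * (r : ℝ) ^ (∑ i, α i)) fun m => ?_
      calc ‖p m‖ * (r : ℝ) ^ m
          ≤ (∑ α ∈ Finset.univ.piAntidiag m, ‖a α‖) * (r : ℝ) ^ m := by
            refine mul_le_mul_of_nonneg_right ?_ (by positivity)
            refine norm_sum_le_of_le _ fun α _ => ?_
            rw [norm_smul]
            exact mul_le_of_le_one_right (norm_nonneg _) (hM1 m α)
        _ = ∑ α ∈ Finset.univ.piAntidiag m, ‖a α‖ * (r : ℝ) ^ (∑ i, α i) := by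
            rw [Finset.sum_mul]
            refine Finset.sum_congr rfl fun α hα => ?_
            have : ∑ i, α i = m := by simpa using hα
            rw [this]
        _ ≤ _ := hs.sum_le_tsum _ fun α _ => by positivity
    · intro y hy
      have hy' : y ∈ polydisc n := by
        rw [polydisc_eq_ball]
        rwa [← ENNReal.ofReal_one, Metric.eball_ofReal] at hy
      have h1 := ((Equiv.sigmaFiberEquiv fun α : Fin n → ℕ => ∑ i, α i).hasSum_iff.2
        (h y hy')).sigma (fun m => hasSum_piAntidiag (fun α => a α * mon y α) m)
      simpa only [hp, zero_add] using h1
  have := hb.analyticOnNhd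
  rwa [← ENNReal.ofReal_one, Metric.eball_ofReal, ← polydisc_eq_ball] at this

theorem coeff_unique {n : ℕ} {f : (Fin n → ℂ) → ℂ} {a b : (Fin n → ℕ) → ℂ}
    (ha : ∀ z ∈ polydisc n, HasSum (fun α => a α * mon z α) (f z))
    (hb : ∀ z ∈ polydisc n, HasSum (fun α => b α * mon z α) (f z)) : a = b := by
  have key : ∀ c : (Fin n → ℕ) → ℂ, (∀ z ∈ polydisc n, HasSum (fun α => c α * mon z α) (f z)) →
      ∀ α, ∫ t, (starRingEnd ℂ) (mon (torusPoint t) α) * f (((1 / 2 : ℝ) : ℂ) • torusPoint t)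
        ∂torusMeasure n = c α * ((1 / 2 : ℝ) : ℂ) ^ ∑ i, α i := by
    intro c hc α
    have h1 : ∀ t : UnitAddTorus (Fin n), HasSum (fun α => c α * ((1 / 2 : ℝ) : ℂ) ^ (∑ i, α i) *
        mon (torusPoint t) α) (f (((1 / 2 : ℝ) : ℂ) • torusPoint t)) := by
      intro t
      have := hc _ (smul_torusPoint_mem (r := 1 / 2) (by norm_num) (by norm_num) t)
      simpa only [mon_smul, mul_assoc] using this
    have h2 : Summable fun α : Fin n → ℕ => c α * ((1 / 2 : ℝ) : ℂ) ^ (∑ i, α i) := by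
      have := (hc (fun _ => ((1 / 2 : ℝ) : ℂ)) (fun i => by
        rw [Complex.norm_real]; norm_num)).summable
      simpa [mon, Finset.prod_pow_eq_pow_sum] using this
    exact (parseval h2 h1).1 α
  funext α
  have h := (key a ha α).symm.trans (key b hb α)
  exact mul_right_cancel₀ (pow_ne_zero _ (by norm_num)) h

theorem hasSum_mean {n : ℕ} {f : (Fin n → ℂ) → ℂ} {a : (Fin n → ℕ) → ℂ}
    (ha : ∀ z ∈ polydisc n, HasSum (fun α => a α * mon z α) (f z)) {r : ℝ} (h0 : 0 ≤ r)
    (h1 : r < 1) : HasSum (fun α => ‖a α‖ ^ 2 * (r ^ (∑ i, α i)) ^ 2)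
      (∫ t, ‖f ((r : ℂ) • torusPoint t)‖ ^ 2 ∂torusMeasure n) := by
  have h2 : ∀ t : UnitAddTorus (Fin n), HasSum (fun α => a α * (r : ℂ) ^ (∑ i, α i) *
      mon (torusPoint t) α) (f ((r : ℂ) • torusPoint t)) := by
    intro t
    have := ha _ (smul_torusPoint_mem h0 h1 t)
    simpa only [mon_smul, mul_assoc] using this
  have h3 : Summable fun α : Fin n → ℕ => a α * (r : ℂ) ^ (∑ i, α i) := by
    have := (ha (fun _ => (r : ℂ)) (fun i => by simpa [abs_of_nonneg h0] using h1)).summable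
    simpa [mon, Finset.prod_pow_eq_pow_sum] using this
  refine ((parseval h3 h2).2).congr_fun fun α => ?_
  rw [norm_mul, norm_pow, Complex.norm_real, Real.norm_of_nonneg h0, mul_pow]

/-- The integral means are bounded by `B` iff the coefficients have `ℓ²` norm at most `B`. -/
theorem integralMean_le_iff {n : ℕ} {f : (Fin n → ℂ) → ℂ} {a : (Fin n → ℕ) → ℂ}
    (ha : ∀ z ∈ polydisc n, HasSum (fun α => a α * mon z α) (f z)) {B : ℝ} (hB : 0 ≤ B) :
    (∀ r : Set.Ico (0 : ℝ) 1, integralMean f r ≤ B) ↔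
      Summable (fun α => ‖a α‖ ^ 2) ∧ ∑' α, ‖a α‖ ^ 2 ≤ B ^ 2 := by
  constructor
  · intro h
    have hfin : ∀ s : Finset (Fin n → ℕ), ∑ α ∈ s, ‖a α‖ ^ 2 ≤ B ^ 2 := by
      intro s
      have hc : Tendsto (fun r : ℝ => ∑ α ∈ s, ‖a α‖ ^ 2 * (r ^ (∑ i, α i)) ^ 2) (𝓝[<] 1)
          (𝓝 (∑ α ∈ s, ‖a α‖ ^ 2 * ((1 : ℝ) ^ (∑ i, α i)) ^ 2)) := by
        refine (Continuous.tendsto ?_ 1).mono_left nhdsWithin_le_nhds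
        fun_prop
      simp only [one_pow, mul_one] at hc
      refine le_of_tendsto hc ?_
      filter_upwards [Ico_mem_nhdsLT (zero_lt_one (α := ℝ))] with r hr
      have h1 := hasSum_mean ha hr.1 hr.2
      refine (sum_le_hasSum s (fun α _ => by positivity) h1).trans ?_
      exact (Real.sqrt_le_left hB).1 (h ⟨r, hr⟩)
    exact ⟨summable_of_sum_le (fun α => by positivity) hfin,
      Real.tsum_le_of_sum_le (fun α => by positivity) hfin⟩
  · rintro ⟨hs, hle⟩ ⟨r, hr⟩
    refine (Real.sqrt_le_left hB).2 (le_trans ?_ hle)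
    refine hasSum_le (fun α => ?_) (hasSum_mean ha hr.1 hr.2) hs.hasSum
    refine mul_le_of_le_one_right (by positivity) (pow_le_one₀ (pow_nonneg hr.1 _) ?_)
    exact pow_le_one₀ hr.1 hr.2.le

/-- Bounded integral means amount to square-summable coefficients. -/
theorem bddAbove_iff {n : ℕ} {f : (Fin n → ℂ) → ℂ} {a : (Fin n → ℕ) → ℂ}
    (ha : ∀ z ∈ polydisc n, HasSum (fun α => a α * mon z α) (f z)) :
    BddAbove (Set.range fun r : Set.Ico (0 : ℝ) 1 => integralMean f r) ↔
      Summable fun α => ‖a α‖ ^ 2 := by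
  constructor
  · rintro ⟨B, hB⟩
    have h : ∀ r : Set.Ico (0 : ℝ) 1, integralMean f r ≤ B := fun r => hB ⟨r, rfl⟩
    have hB0 : 0 ≤ B := (Real.sqrt_nonneg _).trans (h ⟨0, by simp⟩)
    exact ((integralMean_le_iff ha hB0).1 h).1
  · intro hs
    refine ⟨√(∑' α, ‖a α‖ ^ 2), ?_⟩
    rintro _ ⟨r, rfl⟩
    refine (integralMean_le_iff ha (Real.sqrt_nonneg _)).2 ⟨hs, ?_⟩ r
    rw [Real.sq_sqrt (tsum_nonneg fun _ => by positivity)]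

/-- The Hardy norm is the `ℓ²` norm of the coefficients. -/
theorem iSup_integralMean {n : ℕ} {f : (Fin n → ℂ) → ℂ} {a : (Fin n → ℕ) → ℂ}
    (ha : ∀ z ∈ polydisc n, HasSum (fun α => a α * mon z α) (f z))
    (hs : Summable fun α => ‖a α‖ ^ 2) :
    ⨆ r : Set.Ico (0 : ℝ) 1, integralMean f r = √(∑' α, ‖a α‖ ^ 2) := by
  have : Nonempty (Set.Ico (0 : ℝ) 1) := ⟨⟨0, by simp⟩⟩
  apply le_antisymm
  · refine ciSup_le ((integralMean_le_iff ha (Real.sqrt_nonneg _)).2 ⟨hs, ?_⟩)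
    rw [Real.sq_sqrt (tsum_nonneg fun _ => by positivity)]
  · have h0 : 0 ≤ ⨆ r : Set.Ico (0 : ℝ) 1, integralMean f r :=
      Real.iSup_nonneg fun r => Real.sqrt_nonneg _
    refine (Real.sqrt_le_left h0).2 ((integralMean_le_iff ha h0).1 fun r => ?_).2
    exact le_ciSup ((bddAbove_iff ha).2 hs) r

theorem summable_add_sq {ι : Type*} {a b : ι → ℂ} (ha : Summable fun i => ‖a i‖ ^ 2)
    (hb : Summable fun i => ‖b i‖ ^ 2) : Summable fun i => ‖a i + b i‖ ^ 2 := by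
  refine Summable.of_nonneg_of_le (fun _ => by positivity) (fun i => ?_)
    ((ha.mul_left 2).add (hb.mul_left 2))
  have := norm_add_le (a i) (b i)
  nlinarith [norm_nonneg (a i), norm_nonneg (b i), norm_nonneg (a i + b i),
    sq_nonneg (‖a i‖ - ‖b i‖)]

/-- The functions in the Hardy space `H²(𝔻ⁿ)`: analytic functions on the polydisc with bounded
`L²` integral means. A function on the polydisc is represented by its extension by `0`. -/
def hardyFunctions (n : ℕ) : Submodule ℂ ((Fin n → ℂ) → ℂ) where
  carrier := {f | AnalyticOnNhd ℂ f (polydisc n) ∧ (∀ z ∉ polydisc n, f z = 0) ∧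
    BddAbove (Set.range fun r : Set.Ico (0 : ℝ) 1 => integralMean f r)}
  zero_mem' := by
    refine ⟨analyticOnNhd_const, fun _ _ => rfl, 0, ?_⟩
    rintro _ ⟨r, rfl⟩
    simp [integralMean]
  add_mem' := by
    rintro f g ⟨hf, hf0, hfb⟩ ⟨hg, hg0, hgb⟩
    refine ⟨hf.add hg, fun z hz => by simp [hf0 z hz, hg0 z hz], ?_⟩
    obtain ⟨a, ha⟩ := exists_coeff hf
    obtain ⟨b, hb⟩ := exists_coeff hg
    have hab : ∀ z ∈ polydisc n, HasSum (fun α => (a α + b α) * mon z α) ((f + g) z) :=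
      fun z hz => by
        simp only [add_mul]
        exact (ha z hz).add (hb z hz)
    exact (bddAbove_iff hab).2 (summable_add_sq ((bddAbove_iff ha).1 hfb) ((bddAbove_iff hb).1 hgb))
  smul_mem' := by
    rintro c f ⟨hf, hf0, hfb⟩
    refine ⟨hf.const_smul, fun z hz => by simp [hf0 z hz], ?_⟩
    obtain ⟨a, ha⟩ := exists_coeff hf
    have hca : ∀ z ∈ polydisc n, HasSum (fun α => (c * a α) * mon z α) ((c • f) z) :=
      fun z hz => by
        simp only [mul_assoc]
        exact (ha z hz).mul_left c
    refine (bddAbove_iff hca).2 ?_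
    simpa only [norm_mul, mul_pow] using ((bddAbove_iff ha).1 hfb).mul_left (‖c‖ ^ 2)

/-- The Hardy space `H²(𝔻ⁿ)`. -/
def HardySpace (n : ℕ) : Type := hardyFunctions n

instance (n : ℕ) : AddCommGroup (HardySpace n) := inferInstanceAs (AddCommGroup (hardyFunctions n))

instance (n : ℕ) : Module ℂ (HardySpace n) := inferInstanceAs (Module ℂ (hardyFunctions n))

instance (n : ℕ) : CoeFun (HardySpace n) fun _ => (Fin n → ℂ) → ℂ := ⟨fun f => f.1⟩

/-- The Hardy norm `sup_{0 ≤ r < 1} (∫ |f(r z)|² dμ)^{1/2}`. -/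
instance (n : ℕ) : Norm (HardySpace n) := ⟨fun f => ⨆ r : Set.Ico (0 : ℝ) 1, integralMean f r⟩

theorem HardySpace.ext {n : ℕ} {f g : HardySpace n} (h : ∀ z ∈ polydisc n, f z = g z) : f = g := by
  refine Subtype.ext (funext fun z => ?_)
  by_cases hz : z ∈ polydisc n
  · exact h z hz
  · exact (f.2.2.1 z hz).trans (g.2.2.1 z hz).symm

/-- The Taylor coefficients of a Hardy space function. -/
def coeff {n : ℕ} (f : HardySpace n) : (Fin n → ℕ) → ℂ := (exists_coeff f.2.1).choose

theorem hasSum_coeff {n : ℕ} (f : HardySpace n) {z : Fin n → ℂ} (hz : z ∈ polydisc n) :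
    HasSum (fun α => coeff f α * mon z α) (f z) := (exists_coeff f.2.1).choose_spec z hz

theorem coeff_eq {n : ℕ} {f : HardySpace n} {a : (Fin n → ℕ) → ℂ}
    (ha : ∀ z ∈ polydisc n, HasSum (fun α => a α * mon z α) (f z)) : coeff f = a :=
  coeff_unique (fun _ hz => hasSum_coeff f hz) ha

theorem summable_coeff {n : ℕ} (f : HardySpace n) : Summable fun α => ‖coeff f α‖ ^ 2 :=
  (bddAbove_iff fun _ hz => hasSum_coeff f hz).1 f.2.2.2

theorem norm_eq_sqrt_tsum {n : ℕ} (f : HardySpace n) : ‖f‖ = √(∑' α, ‖coeff f α‖ ^ 2) :=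
  iSup_integralMean (fun _ hz => hasSum_coeff f hz) (summable_coeff f)

/-- The Taylor coefficients as a linear map to `ℓ²`. -/
def coeffMap (n : ℕ) : HardySpace n →ₗ[ℂ] lp (fun _ : Fin n → ℕ => ℂ) 2 where
  toFun f := ⟨coeff f, by
    refine (memℓp_gen_iff (by norm_num)).2 ?_
    simpa using summable_coeff f⟩
  map_add' f g := by
    refine Subtype.ext (coeff_eq fun z hz => ?_)
    have := (hasSum_coeff f hz).add (hasSum_coeff g hz)
    simp only [← add_mul] at this
    exact this
  map_smul' c f := by
    refine Subtype.ext (coeff_eq fun z hz => ?_)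
    have := (hasSum_coeff f hz).mul_left c
    simp only [← mul_assoc] at this
    exact this

theorem norm_coeffMap {n : ℕ} (f : HardySpace n) : ‖coeffMap n f‖ = ‖f‖ := by
  have h := lp.norm_rpow_eq_tsum (p := 2) (by norm_num) (coeffMap n f)
  simp only [ENNReal.toReal_ofNat, Real.rpow_ofNat] at h
  rw [norm_eq_sqrt_tsum, eq_comm, Real.sqrt_eq_iff_mul_self_eq (tsum_nonneg fun _ => by positivity)
    (norm_nonneg _), ← sq, h]
  rfl

theorem coeffMap_injective (n : ℕ) : Function.Injective (coeffMap n) := by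
  intro f g h
  have h' : coeff f = coeff g := congrArg Subtype.val h
  refine HardySpace.ext fun z hz => ?_
  have h1 := hasSum_coeff f hz
  rw [h'] at h1
  exact h1.unique (hasSum_coeff g hz)

theorem normCore (n : ℕ) : NormedSpace.Core ℂ (HardySpace n) where
  norm_nonneg f := by rw [← norm_coeffMap]; exact norm_nonneg _
  norm_smul c f := by rw [← norm_coeffMap, ← norm_coeffMap, map_smul, norm_smul]
  norm_triangle f g := by
    rw [← norm_coeffMap, ← norm_coeffMap, ← norm_coeffMap, map_add]; exact norm_add_le _ _
  norm_eq_zero_iff f := by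
    rw [← norm_coeffMap, norm_eq_zero, map_eq_zero_iff _ (coeffMap_injective n)]

instance (n : ℕ) : NormedAddCommGroup (HardySpace n) := NormedAddCommGroup.ofCore (normCore n)

instance (n : ℕ) : NormedSpace ℂ (HardySpace n) := NormedSpace.ofCore (normCore n)

/-- The inner product determined by the Hardy norm through polarization. -/
instance (n : ℕ) : InnerProductSpace ℂ (HardySpace n) :=
  InnerProductSpace.ofNorm ℂ fun f g => by
    simp only [← norm_coeffMap, map_add, map_sub]
    simpa only [sq] using parallelogram_law_with_norm ℂ (coeffMap n f) (coeffMap n g)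

theorem coeffMap_surjective (n : ℕ) : Function.Surjective (coeffMap n) := by
  classical
  intro a
  have hs : Summable fun α => ‖a α‖ ^ 2 := by
    have := (memℓp_gen_iff (p := 2) (by norm_num)).1 a.2
    simpa using this
  let f : (Fin n → ℂ) → ℂ := fun z => if z ∈ polydisc n then ∑' α, a α * mon z α else 0
  have hf : ∀ z ∈ polydisc n, HasSum (fun α => a α * mon z α) (f z) := by
    intro z hz
    simp only [f, if_pos hz]
    refine (summable_of_bound (fun r hr0 hr1 => ⟨‖a‖, fun α => ?_⟩) hz).hasSum
    exact (mul_le_of_le_one_right (norm_nonneg _) (pow_le_one₀ hr0.le hr1.le)).trans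
      (lp.norm_apply_le_norm (by norm_num) a α)
  exact ⟨⟨f, analyticOnNhd_of_hasSum hf, fun z hz => if_neg hz, (bddAbove_iff hf).2 hs⟩,
    Subtype.ext (coeff_eq hf)⟩

/-- The Taylor coefficients identify the Hardy space with `ℓ²`. -/
def coeffEquiv (n : ℕ) : HardySpace n ≃ₗᵢ[ℂ] lp (fun _ : Fin n → ℕ => ℂ) 2 where
  toLinearEquiv := LinearEquiv.ofBijective (coeffMap n)
    ⟨coeffMap_injective n, coeffMap_surjective n⟩
  norm_map' := norm_coeffMap

instance (n : ℕ) : CompleteSpace (HardySpace n) := (coeffEquiv n).toIsometryEquiv.completeSpace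

/-- The shift `M_{z_j}`, that is, multiplication by the coordinate `z_j`. -/
def shift {n : ℕ} (j : Fin n) : HardySpace n →L[ℂ] HardySpace n :=
  have hle (f : HardySpace n) (r : Set.Ico (0 : ℝ) 1) :
      integralMean (fun z => z j * f z) r ≤ integralMean f r := by
    have h : integralMean (fun z => z j * f z) r = r * integralMean f r := by
      have h1 : ∀ t : UnitAddTorus (Fin n),
          ‖(((r : ℝ) : ℂ) • torusPoint t) j * f (((r : ℝ) : ℂ) • torusPoint t)‖ ^ 2 =
            (r : ℝ) ^ 2 * ‖f (((r : ℝ) : ℂ) • torusPoint t)‖ ^ 2 := by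
        intro t
        simp [norm_torusPoint_apply, mul_pow]
      simp only [integralMean, h1, integral_const_mul]
      rw [Real.sqrt_mul (by positivity), Real.sqrt_sq r.2.1]
    rw [h]
    exact mul_le_of_le_one_left (Real.sqrt_nonneg _) r.2.2.le
  LinearMap.mkContinuous
    { toFun := fun f => ⟨fun z => z j * f z, by
        refine ⟨((ContinuousLinearMap.proj (R := ℂ) (φ := fun _ : Fin n => ℂ) j).analyticOnNhd
          _).mul f.2.1, fun z hz => by simp [f.2.2.1 z hz], ?_⟩
        obtain ⟨B, hB⟩ := f.2.2.2
        refine ⟨B, ?_⟩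
        rintro _ ⟨r, rfl⟩
        exact (hle f r).trans (hB ⟨r, rfl⟩)⟩
      map_add' := fun f g => HardySpace.ext fun z _ => mul_add _ _ _
      map_smul' := fun c f => HardySpace.ext fun z _ => mul_left_comm _ _ _ }
    1 fun f => by
      rw [one_mul]
      exact ciSup_mono f.2.2.2 (hle f)

theorem shift_apply {n : ℕ} (j : Fin n) (f : HardySpace n) (z : Fin n → ℂ) :
    shift j f z = z j * f z := rfl

theorem update_mem_polydisc {n : ℕ} (j : Fin n) {z : Fin n → ℂ} (hz : z ∈ polydisc n) :
    Function.update z j 0 ∈ polydisc n := by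
  intro i
  rcases eq_or_ne i j with h | h
  · subst h; simp
  · simpa [h] using hz i

open Classical in
/-- The function `f(z_1, …, z_{j-1}, 0, z_{j+1}, …, z_n)` on the polydisc. -/
def evalZeroFun {n : ℕ} (j : Fin n) (f : (Fin n → ℂ) → ℂ) : (Fin n → ℂ) → ℂ :=
  fun z => if z ∈ polydisc n then f (Function.update z j 0) else 0

theorem hasSum_evalZeroFun {n : ℕ} (j : Fin n) (f : HardySpace n) {z : Fin n → ℂ}
    (hz : z ∈ polydisc n) : HasSum (fun α => (if α j = 0 then coeff f α else 0) * mon z α)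
      (evalZeroFun j f z) := by
  have h := hasSum_coeff f (update_mem_polydisc j hz)
  simp only [evalZeroFun, if_pos hz]
  refine h.congr_fun fun α => ?_
  split_ifs with h0
  · congr 1
    refine Finset.prod_congr rfl fun i _ => ?_
    rcases eq_or_ne i j with hi | hi
    · subst hi; simp [h0]
    · simp [hi]
  · have : mon (Function.update z j 0) α = 0 :=
      Finset.prod_eq_zero (Finset.mem_univ j) (by simp [h0])
    simp [this]

theorem norm_ite_coeff_le {n : ℕ} (j : Fin n) (f : HardySpace n) (α : Fin n → ℕ) :
    ‖if α j = 0 then coeff f α else 0‖ ^ 2 ≤ ‖coeff f α‖ ^ 2 := by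
  split_ifs <;> simp

theorem summable_ite_coeff {n : ℕ} (j : Fin n) (f : HardySpace n) :
    Summable fun α : Fin n → ℕ => ‖if α j = 0 then coeff f α else 0‖ ^ 2 :=
  Summable.of_nonneg_of_le (fun _ => by positivity) (norm_ite_coeff_le j f) (summable_coeff f)

/-- The evaluation operator `ev_{z_j}`, which evaluates the `j`-th variable at `0`. -/
def evalZero {n : ℕ} (j : Fin n) : HardySpace n →L[ℂ] HardySpace n :=
  LinearMap.mkContinuous
    { toFun := fun f => ⟨evalZeroFun j f,
        analyticOnNhd_of_hasSum fun _ hz => hasSum_evalZeroFun j f hz, fun _ hz => if_neg hz,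
        (bddAbove_iff fun _ hz => hasSum_evalZeroFun j f hz).2 (summable_ite_coeff j f)⟩
      map_add' := fun f g => HardySpace.ext fun z hz => by
        change evalZeroFun j (f.1 + g.1) z = evalZeroFun j f z + evalZeroFun j g z
        simp [evalZeroFun, hz]
      map_smul' := fun c f => HardySpace.ext fun z hz => by
        change evalZeroFun j (c • f.1) z = c * evalZeroFun j f z
        simp [evalZeroFun, hz] }
    1 fun f => by
      rw [one_mul, norm_eq_sqrt_tsum f]
      refine (iSup_integralMean (fun _ hz => hasSum_evalZeroFun j f hz)
        (summable_ite_coeff j f)).le.trans (Real.sqrt_le_sqrt ?_)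
      exact (summable_ite_coeff j f).tsum_le_tsum (norm_ite_coeff_le j f) (summable_coeff f)

theorem evalZero_apply {n : ℕ} (j : Fin n) (f : HardySpace n) {z : Fin n → ℂ}
    (hz : z ∈ polydisc n) : evalZero j f z = f (Function.update z j 0) := if_pos hz

/-- A submodule of `H²(𝔻ⁿ)`: a closed subspace that is invariant under all the shifts. -/
structure ShiftSubmodule (n : ℕ) extends Submodule ℂ (HardySpace n) where
  isClosed' : IsClosed (carrier : Set (HardySpace n))
  shift_mem' : ∀ (j : Fin n), ∀ f ∈ carrier, shift j f ∈ carrier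

namespace ShiftSubmodule

variable {n : ℕ} (S : ShiftSubmodule n)

instance : CompleteSpace S.toSubmodule := S.isClosed'.completeSpace_coe

/-- The restriction operator `R_{z_j} = M_{z_j}|_S` on `S`. -/
def R (j : Fin n) : S.toSubmodule →L[ℂ] S.toSubmodule :=
  ((shift j).comp S.toSubmodule.subtypeL).codRestrict S.toSubmodule
    fun f => S.shift_mem' j f.1 f.2

/-- The evaluation operator `E_{z_j} = P_S ∘ ev_{z_j} : H²(𝔻ⁿ) → S`. -/
def E (j : Fin n) : HardySpace n →L[ℂ] S.toSubmodule :=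
  S.toSubmodule.orthogonalProjectionOnto.comp (evalZero j)

end ShiftSubmodule

/-- Inner functions on the polydisc: bounded analytic functions whose radial boundary values exist
and are unimodular at almost every point of the torus. -/
structure IsInner {n : ℕ} (θ : (Fin n → ℂ) → ℂ) : Prop where
  analytic : AnalyticOnNhd ℂ θ (polydisc n)
  bounded : ∃ C : ℝ, ∀ z ∈ polydisc n, ‖θ z‖ ≤ C
  unimodular : ∀ᵐ t ∂torusMeasure n, ∃ w : ℂ, ‖w‖ = 1 ∧
    Tendsto (fun r : ℝ => θ ((r : ℂ) • torusPoint t)) (𝓝[<] 1) (𝓝 w)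

/-- On the polydisc, `θ` depends only on the variable `z_i`. -/
def DependsOnlyOn {n : ℕ} (θ : (Fin n → ℂ) → ℂ) (i : Fin n) : Prop :=
  ∀ z ∈ polydisc n, ∀ w ∈ polydisc n, z i = w i → θ z = θ w

/-- The set `θ H²(𝔻ⁿ)` of all products `θ f` with `f ∈ H²(𝔻ⁿ)`, as functions on the polydisc
extended by `0`. -/
def mulHardy {n : ℕ} (θ : (Fin n → ℂ) → ℂ) : Set ((Fin n → ℂ) → ℂ) :=
  {g | ∃ f : HardySpace n, g = fun z => θ z * f z}

end PolydiscHardy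

end

/-!
Write `M_j` for the shift in `z_j` and `M_j^*` for its adjoint. Evaluation at `z_j = 0` is the
projection `I - M_j M_j^*`, so that a function does not depend on `z_j` exactly when `M_j^*`
annihilates it. The operator `I - R_j R_j^*` is the projection of `S` onto `S ⊖ z_j S`, and
`I - E_j E_j^*` annihilates exactly the elements of `S` that do not depend on `z_j`, because
`⟪(I - E_j E_j^*) g, g⟫ = ‖M_j^* g‖²`. The identity thus says that `S ⊖ z_j S` consists of functions that do not depend on `z_j`
(`ShiftSubmodule.comp_eq_zero_iff`).

If `S = θ(z_i) H²` and `j ≠ i`, then `g - g|_{z_j = 0}` lies in `z_j S` for `g ∈ S`. For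
`g ∈ S ⊖ z_j S` this difference `M_j M_j^* g` is therefore orthogonal to `g`, and `M_j^* g = 0`
(`backShift_eq_zero_of_mulHardy`).

Conversely, the identity implies that `S` is invariant under `M_j^*` for all `j ≠ i`
(`ShiftSubmodule.backShift_mem`), and `exists_generator` proves Beurling's theorem for such `S`. The
closed subspace `K` of functions in `S` that depend on `z_i` only is nonzero and contains a unit
vector `θ` orthogonal to `z_i K`. The functions `z ^ α θ` are orthonormal, so multiplication by `θ`
is an isometry `V` with range in `S`. If the range were smaller than `S`, its orthogonal complement
in `S` would contain nonzero functions of `z_i` alone, and among these a second vector `ψ` of the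
same kind with `θ H²` orthogonal to `ψ H²`; but `θ ψ` lies in both spaces.

It remains to see that `θ` is inner. The reproducing kernels are eigenvectors of `V^*`, whence
`|θ| ≤ 1`. The radial limits exist almost everywhere by Fatou's theorem on the circle
(`ae_tendsto_integral_circlePoisson`), proved by comparing the Poisson kernel with averages over
dyadic balls around a Lebesgue point. They are bounded by `1` and have mean square `‖θ‖² = 1`, hence
they are unimodular (`isInner_of_norm_le_one`).
-/

noncomputable section

namespace PolydiscHardy

variable {n : ℕ}

/-! ### Taylor coefficients, monomials and the inner product -/

theorem ext_coeff {f g : HardySpace n} (h : ∀ α, coeff f α = coeff g α) : f = g :=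
  coeffMap_injective n (Subtype.ext (funext h))

theorem coeff_zero (α : Fin n → ℕ) : coeff (0 : HardySpace n) α = 0 :=
  congrFun (congrArg Subtype.val (map_zero (coeffMap n))) α

theorem coeff_sub (f g : HardySpace n) (α : Fin n → ℕ) :
    coeff (f - g) α = coeff f α - coeff g α :=
  congrFun (congrArg Subtype.val (map_sub (coeffMap n) f g)) α

theorem coe_sub_apply (f g : HardySpace n) (z : Fin n → ℂ) : (f - g) z = f z - g z := rfl

theorem hasSum_inner (f g : HardySpace n) :
    HasSum (fun α => inner ℂ (coeff f α) (coeff g α)) (inner ℂ f g) := by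
  rw [← (coeffEquiv n).inner_map_map]
  exact lp.hasSum_inner (coeffEquiv n f) (coeffEquiv n g)

theorem hasSum_norm_sq (f : HardySpace n) : HasSum (fun α => ‖coeff f α‖ ^ 2) (‖f‖ ^ 2) := by
  rw [norm_eq_sqrt_tsum, Real.sq_sqrt (tsum_nonneg fun _ => by positivity)]
  exact (summable_coeff f).hasSum

theorem exists_coeff_eq {a : (Fin n → ℕ) → ℂ} (ha : Summable fun α => ‖a α‖ ^ 2) :
    ∃ f : HardySpace n, coeff f = a := by
  obtain ⟨f, hf⟩ := coeffMap_surjective n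
    ⟨a, (memℓp_gen_iff (by norm_num)).2 (by simpa using ha)⟩
  exact ⟨f, congrArg Subtype.val hf⟩

theorem mon_add (z : Fin n → ℂ) (α β : Fin n → ℕ) : mon z (α + β) = mon z α * mon z β := by
  simp [mon, pow_add, Finset.prod_mul_distrib]

theorem mon_single (z : Fin n → ℂ) (j : Fin n) (k : ℕ) : mon z (Pi.single j k) = z j ^ k := by
  rw [mon, Finset.prod_eq_single j]
  · simp
  · intro l _ hl; simp [hl]
  · simp

open Classical in
/-- Sums over the translate of a family `c` by `α` (extended by zero) are sums over `c`; the terms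
are general functions `F` of the index and the coefficient, to cover power series and norms. -/
theorem hasSum_add_index (α : Fin n → ℕ) {c : (Fin n → ℕ) → ℂ} {M : Type*} [AddCommMonoid M]
    [TopologicalSpace M] {F : (Fin n → ℕ) → ℂ → M} (hF : ∀ β, F β 0 = 0) {s : M} :
    HasSum (fun β => F β (if α ≤ β then c (β - α) else 0)) s ↔
      HasSum (fun β => F (α + β) (c β)) s := by
  rw [← (add_right_injective α).hasSum_iff]
  · simp [Function.comp_def]
  · intro β hβ
    rw [if_neg, hF]
    exact fun h => hβ ⟨β - α, by simp [add_tsub_cancel_of_le h]⟩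

open Classical in
theorem hasSum_mon_mul (α : Fin n → ℕ) (f : HardySpace n) {z : Fin n → ℂ} (hz : z ∈ polydisc n) :
    HasSum (fun β => (if α ≤ β then coeff f (β - α) else 0) * mon z β) (mon z α * f z) := by
  refine (hasSum_add_index α (F := fun β x => x * mon z β) (fun β => zero_mul _)).2 ?_
  refine ((hasSum_coeff f hz).mul_left (mon z α)).congr_fun fun β => ?_
  rw [mon_add]; ring

/-- The function `z ^ α f` in the Hardy space. -/
def monMul (α : Fin n → ℕ) (f : HardySpace n) : HardySpace n :=
  ⟨fun z => mon z α * f z, analyticOnNhd_of_hasSum fun _ hz => hasSum_mon_mul α f hz,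
    fun z hz => by simp [f.2.2.1 z hz],
    (bddAbove_iff fun _ hz => hasSum_mon_mul α f hz).2
      ((hasSum_add_index α (F := fun _ x => ‖x‖ ^ 2) (by simp)).2
        (summable_coeff f).hasSum).summable⟩

theorem monMul_apply (α : Fin n → ℕ) (f : HardySpace n) (z : Fin n → ℂ) :
    monMul α f z = mon z α * f z := rfl

open Classical in
theorem coeff_monMul (α : Fin n → ℕ) (f : HardySpace n) (β : Fin n → ℕ) :
    coeff (monMul α f) β = if α ≤ β then coeff f (β - α) else 0 :=
  congrFun (coeff_eq (f := monMul α f) fun _ hz => hasSum_mon_mul α f hz) β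

theorem inner_monMul_monMul (α : Fin n → ℕ) (f g : HardySpace n) :
    inner ℂ (monMul α f) (monMul α g) = inner ℂ f g := by
  refine (hasSum_inner _ _).unique ?_
  rw [← (add_right_injective α).hasSum_iff]
  · refine (hasSum_inner f g).congr_fun fun β => ?_
    simp [Function.comp, coeff_monMul]
  · intro β hβ
    rw [coeff_monMul, if_neg, inner_zero_left]
    exact fun h => hβ ⟨β - α, by simp [add_tsub_cancel_of_le h]⟩

theorem monMul_zero (f : HardySpace n) : monMul 0 f = f :=
  HardySpace.ext fun z _ => by simp [monMul_apply, mon]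

theorem monMul_add (α β : Fin n → ℕ) (f : HardySpace n) :
    monMul (α + β) f = monMul α (monMul β f) :=
  HardySpace.ext fun z _ => by simp [monMul_apply, mon_add, mul_assoc]

theorem shift_eq_monMul (j : Fin n) (f : HardySpace n) : shift j f = monMul (Pi.single j 1) f :=
  HardySpace.ext fun z _ => by simp [monMul_apply, mon_single, shift_apply]

theorem shift_monMul (α : Fin n → ℕ) (j : Fin n) (f : HardySpace n) :
    shift j (monMul α f) = monMul (α + Pi.single j 1) f := by
  rw [add_comm, monMul_add, shift_eq_monMul]

theorem exists_eq_add_single {α : Fin n → ℕ} {j : Fin n} (h : α j ≠ 0) :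
    ∃ β : Fin n → ℕ, α = β + Pi.single j 1 := by
  refine ⟨α - Pi.single j 1, (tsub_add_cancel_of_le fun l => ?_).symm⟩
  rcases eq_or_ne l j with rfl | hl
  · simpa using Nat.one_le_iff_ne_zero.2 h
  · simp [hl]

theorem coeff_shift_add_single (j : Fin n) (f : HardySpace n) (α : Fin n → ℕ) :
    coeff (shift j f) (α + Pi.single j 1) = coeff f α := by
  simp [shift_eq_monMul, coeff_monMul]

theorem coeff_shift_of_eq_zero (j : Fin n) (f : HardySpace n) {α : Fin n → ℕ} (h : α j = 0) :
    coeff (shift j f) α = 0 := by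
  rw [shift_eq_monMul, coeff_monMul, if_neg]
  intro hle
  have := hle j
  simp [h] at this

theorem inner_shift_shift (j : Fin n) (f g : HardySpace n) :
    inner ℂ (shift j f) (shift j g) = inner ℂ f g := by
  simp only [shift_eq_monMul, inner_monMul_monMul]

/-- Any subspace invariant under the shifts is invariant under multiplication by monomials in the
corresponding variables. -/
theorem monMul_mem {S : Submodule ℂ (HardySpace n)} {p : Fin n → Prop}
    (hS : ∀ j, p j → ∀ f ∈ S, shift j f ∈ S) {f : HardySpace n} (hf : f ∈ S) (α : Fin n → ℕ)
    (hα : ∀ j, α j ≠ 0 → p j) : monMul α f ∈ S := by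
  induction hm : ∑ j, α j generalizing α with
  | zero =>
    have : α = 0 := by
      funext j
      simpa using (Finset.sum_eq_zero_iff.1 hm) j (Finset.mem_univ j)
    rwa [this, monMul_zero]
  | succ m ih =>
    obtain ⟨j, hj⟩ : ∃ j, α j ≠ 0 := by
      by_contra! h
      simp [h] at hm
    have hp := hα j hj
    obtain ⟨β, rfl⟩ := exists_eq_add_single hj
    rw [← shift_monMul]
    refine hS j hp _ (ih β (fun l hl => hα l ?_) ?_)
    · simp only [Pi.add_apply]; omega
    · simpa [Finset.sum_add_distrib] using hm

/-! ### Backward shifts and evaluation at zero -/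

/-- The backward shift, the adjoint of `M_{z_j}`. -/
abbrev backShift (j : Fin n) : HardySpace n →L[ℂ] HardySpace n :=
  ContinuousLinearMap.adjoint (shift j)

theorem backShift_shift (j : Fin n) (f : HardySpace n) : backShift j (shift j f) = f :=
  ext_inner_left ℂ fun g => by
    rw [ContinuousLinearMap.adjoint_inner_right, inner_shift_shift]

/-- The monomials, as vectors that represent the Taylor coefficients. -/
theorem exists_coeff_eq_inner (α : Fin n → ℕ) :
    ∃ e : HardySpace n, (∀ β, coeff e β = if β = α then 1 else 0) ∧
      ∀ f : HardySpace n, inner ℂ e f = coeff f α := by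
  obtain ⟨e, he⟩ := exists_coeff_eq (n := n) (a := fun β => if β = α then 1 else 0)
    (summable_of_ne_finset_zero (s := {α}) fun β hβ => by
      simp only [Finset.mem_singleton] at hβ; simp [hβ])
  refine ⟨e, congrFun he, fun f => (hasSum_inner e f).unique ?_⟩
  rw [he]
  have h := hasSum_single (f := fun β => inner ℂ (if β = α then (1 : ℂ) else 0) (coeff f β)) α
    fun β hβ => by simp [hβ]
  simpa using h

theorem coeff_backShift (j : Fin n) (f : HardySpace n) (α : Fin n → ℕ) :
    coeff (backShift j f) α = coeff f (α + Pi.single j 1) := by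
  obtain ⟨e, he, hi⟩ := exists_coeff_eq_inner α
  obtain ⟨e', he', hi'⟩ := exists_coeff_eq_inner (α + Pi.single j 1)
  have : shift j e = e' := ext_coeff fun β => by
    by_cases hβ : β j = 0
    · rw [coeff_shift_of_eq_zero j _ hβ, he', if_neg]
      rintro rfl
      simp at hβ
    · obtain ⟨γ, rfl⟩ := exists_eq_add_single hβ
      rw [coeff_shift_add_single, he, he']
      simp
  rw [← hi, ContinuousLinearMap.adjoint_inner_right, this, hi']

theorem coeff_evalZero (j : Fin n) (f : HardySpace n) (α : Fin n → ℕ) :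
    coeff (evalZero j f) α = if α j = 0 then coeff f α else 0 :=
  congrFun (coeff_eq (f := evalZero j f) fun _ hz => hasSum_evalZeroFun j f hz) α

/-- Evaluation at `z_j = 0` is the projection onto the kernel of the backward shift. -/
theorem evalZero_eq (j : Fin n) (f : HardySpace n) :
    evalZero j f = f - shift j (backShift j f) := by
  refine ext_coeff fun α => ?_
  rw [coeff_evalZero, coeff_sub]
  split_ifs with h
  · rw [coeff_shift_of_eq_zero j _ h, sub_zero]
  · obtain ⟨β, rfl⟩ := exists_eq_add_single h
    rw [coeff_shift_add_single, coeff_backShift, sub_self]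

theorem backShift_evalZero (j : Fin n) (f : HardySpace n) : backShift j (evalZero j f) = 0 := by
  rw [evalZero_eq, map_sub, backShift_shift, sub_self]

theorem adjoint_evalZero (j : Fin n) :
    ContinuousLinearMap.adjoint (evalZero (n := n) j) = evalZero j := by
  symm
  rw [ContinuousLinearMap.eq_adjoint_iff]
  intro f g
  rw [evalZero_eq, evalZero_eq, inner_sub_left, inner_sub_right,
    ← ContinuousLinearMap.adjoint_inner_right (shift j),
    ← ContinuousLinearMap.adjoint_inner_left (shift j)]

theorem norm_sq_eq_evalZero_add (j : Fin n) (f : HardySpace n) :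
    ‖f‖ ^ 2 = ‖evalZero j f‖ ^ 2 + ‖backShift j f‖ ^ 2 := by
  have h : inner ℂ (evalZero j f) (shift j (backShift j f)) = 0 := by
    rw [← ContinuousLinearMap.adjoint_inner_left, backShift_evalZero, inner_zero_left]
  have h1 : f = evalZero j f + shift j (backShift j f) := by rw [evalZero_eq]; abel
  have h2 : ‖shift j (backShift j f)‖ = ‖backShift j f‖ := by
    rw [norm_eq_sqrt_re_inner (𝕜 := ℂ), inner_shift_shift, ← norm_eq_sqrt_re_inner]
  have h3 := norm_add_sq_eq_norm_sq_add_norm_sq_of_inner_eq_zero _ _ h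
  rw [← h1, h2] at h3
  nlinarith

theorem backShift_shift_comm {j l : Fin n} (h : l ≠ j) (f : HardySpace n) :
    backShift l (shift j f) = shift j (backShift l f) := by
  refine ext_coeff fun α => ?_
  rw [coeff_backShift]
  by_cases hα : α j = 0
  · rw [coeff_shift_of_eq_zero j _ hα, coeff_shift_of_eq_zero j]
    simp [hα, h.symm]
  · obtain ⟨β, rfl⟩ := exists_eq_add_single hα
    rw [add_right_comm, coeff_shift_add_single, coeff_shift_add_single, coeff_backShift]

theorem backShift_comm (j l : Fin n) (f : HardySpace n) :
    backShift l (backShift j f) = backShift j (backShift l f) :=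
  ext_coeff fun α => by simp only [coeff_backShift, add_right_comm]

/-- A function annihilated by the backward shift in `z_j` has no coefficients involving `z_j`. -/
theorem coeff_eq_zero_of_backShift {j : Fin n} {f : HardySpace n} (h : backShift j f = 0)
    {α : Fin n → ℕ} (hα : α j ≠ 0) : coeff f α = 0 := by
  obtain ⟨β, rfl⟩ := exists_eq_add_single hα
  rw [← coeff_backShift, h, coeff_zero]

/-! ### Reproducing kernels -/

/-- Point evaluations on the polydisc are represented by nonzero vectors. -/
theorem exists_kernel {z : Fin n → ℂ} (hz : z ∈ polydisc n) :
    ∃ k : HardySpace n, k ≠ 0 ∧ ∀ f : HardySpace n, inner ℂ k f = f z := by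
  have hs : Summable fun α => ‖(starRingEnd ℂ) (mon z α)‖ ^ 2 := by
    have h := summable_pi_prod (c := fun i k => (‖z i‖ ^ 2) ^ k) (fun i k => by positivity)
      (fun i => summable_geometric_of_lt_one (by positivity)
        (pow_lt_one₀ (norm_nonneg _) (hz i) two_ne_zero))
    refine h.congr fun α => ?_
    rw [RCLike.norm_conj, norm_mon, ← Finset.prod_pow]
    exact Finset.prod_congr rfl fun i _ => by ring
  obtain ⟨k, hk⟩ := exists_coeff_eq hs
  refine ⟨k, ?_, fun f => (hasSum_inner k f).unique ?_⟩
  · rintro rfl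
    have := congrFun hk 0
    simp [coeff_zero, mon] at this
  · rw [hk]
    refine (hasSum_coeff f hz).congr_fun fun α => ?_
    simp

/-! ### Wandering vectors -/

theorem norm_shift (j : Fin n) (f : HardySpace n) : ‖shift j f‖ = ‖f‖ := by
  rw [norm_eq_sqrt_re_inner (𝕜 := ℂ), inner_shift_shift, ← norm_eq_sqrt_re_inner]

/-- A nonzero subspace reducing some of the shifts contains a nonzero function that does not depend
on the corresponding variables. -/
theorem exists_backShift_eq_zero {S : Submodule ℂ (HardySpace n)} {s : Finset (Fin n)}
    (h1 : ∀ j ∈ s, ∀ f ∈ S, shift j f ∈ S) (h2 : ∀ j ∈ s, ∀ f ∈ S, backShift j f ∈ S)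
    (hS : S ≠ ⊥) : ∃ f ∈ S, f ≠ 0 ∧ ∀ j ∈ s, backShift j f = 0 := by
  induction s using Finset.induction_on with
  | empty =>
    obtain ⟨f, hf, h0⟩ := S.ne_bot_iff.1 hS
    exact ⟨f, hf, h0, by simp⟩
  | insert j t hj ih =>
    obtain ⟨f, hf, h0, ht⟩ := ih (fun l hl => h1 l (Finset.mem_insert_of_mem hl))
      (fun l hl => h2 l (Finset.mem_insert_of_mem hl))
    obtain ⟨α, hα⟩ : ∃ α, coeff f α ≠ 0 := by
      by_contra! h
      exact h0 (ext_coeff fun α => by rw [h, coeff_zero])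
    -- Stripping `z_j ^ α_j` moves the coefficient at `α` to an index without `z_j`.
    have hk : ∀ k : ℕ, ∃ g ∈ S, (∀ l ∈ t, backShift l g = 0) ∧
        ∀ β, coeff g β = coeff f (β + Pi.single j k) := by
      intro k
      induction k with
      | zero => exact ⟨f, hf, ht, fun β => by simp⟩
      | succ k ihk =>
        obtain ⟨g, hg, hgt, hgc⟩ := ihk
        refine ⟨backShift j g, h2 j (Finset.mem_insert_self _ _) g hg, fun l hl => ?_, fun β => ?_⟩
        · rw [backShift_comm, hgt l hl, map_zero]
        · rw [coeff_backShift, hgc, add_assoc, ← Pi.single_add, add_comm 1 k]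
    obtain ⟨g, hg, hgt, hgc⟩ := hk (α j)
    have hjt := Finset.mem_insert_self j t
    refine ⟨evalZero j g, ?_, ?_, ?_⟩
    · rw [evalZero_eq]
      exact S.sub_mem hg (h1 j hjt _ (h2 j hjt g hg))
    · intro h
      have hc : coeff (evalZero j g) (Function.update α j 0) = coeff f α := by
        rw [coeff_evalZero, if_pos (by simp), hgc]
        congr 1
        funext l
        rcases eq_or_ne l j with rfl | hl <;> simp [*]
      rw [h, coeff_zero] at hc
      exact hα hc.symm
    · intro l hl
      rcases Finset.mem_insert.1 hl with rfl | hl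
      · exact backShift_evalZero l g
      · have hlj : l ≠ j := fun h => hj (h ▸ hl)
        rw [evalZero_eq, map_sub, backShift_shift_comm hlj, backShift_comm, hgt l hl]
        simp

/-- A nonzero closed subspace `L` invariant under `M_{z_i}` contains a unit vector orthogonal to
`z_i L`: otherwise `L = z_i L`, so that all elements of `L` vanish to infinite order in `z_i`. -/
theorem exists_wandering {i : Fin n} {L : Submodule ℂ (HardySpace n)}
    (hc : IsClosed (L : Set (HardySpace n))) (hM : ∀ f ∈ L, shift i f ∈ L) (hL : L ≠ ⊥) :
    ∃ ψ ∈ L, ‖ψ‖ = 1 ∧ ∀ f ∈ L, inner ℂ ψ (shift i f) = 0 := by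
  by_contra! hcon
  let N : Submodule ℂ (HardySpace n) := L.map (shift i).toLinearMap
  have hN : IsClosed (N : Set (HardySpace n)) := by
    have : Isometry (shift (n := n) i) := AddMonoidHomClass.isometry_of_norm _ (norm_shift i)
    exact this.isClosedEmbedding.isClosedMap _ hc
  have : CompleteSpace N := hN.completeSpace_coe
  have hNL : N ≤ L := by
    rintro _ ⟨f, hf, rfl⟩
    exact hM f hf
  have hLN : ∀ f ∈ L, f ∈ N := by
    intro f hf
    have hmem := N.starProjection_apply_mem f
    have hg : f - N.starProjection f ∈ Nᗮ := N.sub_starProjection_mem_orthogonal f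
    have hgL : f - N.starProjection f ∈ L := L.sub_mem hf (hNL hmem)
    by_contra hfN
    have hg0 : f - N.starProjection f ≠ 0 := by
      intro h0
      rw [sub_eq_zero] at h0
      exact hfN (h0 ▸ hmem)
    obtain ⟨u, hu, hu'⟩ := hcon _ (L.smul_mem ((‖f - N.starProjection f‖ : ℂ)⁻¹) hgL)
      (by rw [norm_smul]; simp [norm_ne_zero_iff.2 hg0])
    refine hu' ?_
    have h0 : inner ℂ (f - N.starProjection f) (shift i u) = 0 :=
      (N.mem_orthogonal' _).1 hg _ ⟨u, hu, rfl⟩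
    rw [inner_smul_left, h0, mul_zero]
  obtain ⟨f, hf, h0⟩ := L.ne_bot_iff.1 hL
  have key : ∀ k : ℕ, ∀ f ∈ L, ∀ α : Fin n → ℕ, α i = k → coeff f α = 0 := by
    intro k
    induction k with
    | zero =>
      intro f hf α hα
      obtain ⟨g, -, rfl⟩ := hLN f hf
      exact coeff_shift_of_eq_zero i g hα
    | succ k ih =>
      intro f hf α hα
      obtain ⟨g, hg, rfl⟩ := hLN f hf
      obtain ⟨β, rfl⟩ := exists_eq_add_single (α := α) (j := i) (by omega)
      exact (coeff_shift_add_single i g β).trans (ih g hg β (by simpa using hα))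
  exact h0 (ext_coeff fun α => by rw [key _ f hf α rfl, coeff_zero])

/-! ### Multiplication by a function of one variable -/

/-- Inner products of `z ^ α θ` and `z ^ β ψ`, for `θ` and `ψ` depending on `z_i` only, reduce to
those with exponents that differ by a power of `z_i`. -/
theorem inner_monMul_eq_zero {i : Fin n} {θ ψ : HardySpace n}
    (hθ : ∀ j, j ≠ i → backShift j θ = 0) (hψ : ∀ j, j ≠ i → backShift j ψ = 0)
    {α β : Fin n → ℕ}
    (h1 : ∀ k, α = β + Pi.single i k → inner ℂ (monMul (Pi.single i k) θ) ψ = 0)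
    (h2 : ∀ k, β = α + Pi.single i k → inner ℂ θ (monMul (Pi.single i k) ψ) = 0) :
    inner ℂ (monMul α θ) (monMul β ψ) = 0 := by
  by_cases h : ∀ j, j ≠ i → α j = β j
  · have haux : ∀ α β : Fin n → ℕ, (∀ j, j ≠ i → α j = β j) → α i ≤ β i →
        β = α + Pi.single i (β i - α i) := by
      intro α β h hle
      funext j
      rcases eq_or_ne j i with rfl | hj
      · simp [hle]
      · simp [hj, h j hj]
    rcases le_total (α i) (β i) with hle | hle
    · have hβ := haux α β h hle
      rw [hβ, monMul_add, inner_monMul_monMul, h2 _ hβ]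
    · have hα := haux β α (fun j hj => (h j hj).symm) hle
      rw [hα, monMul_add, inner_monMul_monMul, h1 _ hα]
  · push Not at h
    obtain ⟨j, hj, hne⟩ := h
    refine (hasSum_inner _ _).unique ?_
    convert hasSum_zero with γ
    -- The two series have no monomial in common: their exponents of `z_j` are `α_j` and `β_j`.
    rw [coeff_monMul, coeff_monMul]
    by_cases ha : α ≤ γ
    · by_cases hb : β ≤ γ
      · have haj : α j ≤ γ j := ha j
        have hbj : β j ≤ γ j := hb j
        rw [if_pos ha, if_pos hb]
        rcases eq_or_ne (γ j) (α j) with he | he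
        · rw [coeff_eq_zero_of_backShift (α := γ - β) (hψ j hj), inner_zero_right]
          rw [Pi.sub_apply]; omega
        · rw [coeff_eq_zero_of_backShift (α := γ - α) (hθ j hj), inner_zero_left]
          rw [Pi.sub_apply]; omega
      · rw [if_neg hb, inner_zero_right]
    · rw [if_neg ha, inner_zero_left]

theorem inner_monMul_single {L : Submodule ℂ (HardySpace n)} {i : Fin n} {ψ : HardySpace n}
    (hM : ∀ f ∈ L, shift i f ∈ L) (hψ : ∀ f ∈ L, inner ℂ ψ (shift i f) = 0) {f : HardySpace n}
    (hf : f ∈ L) {k : ℕ} (hk : k ≠ 0) : inner ℂ ψ (monMul (Pi.single i k) f) = 0 := by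
  obtain ⟨m, rfl⟩ := Nat.exists_eq_succ_of_ne_zero hk
  rw [Nat.succ_eq_add_one, Pi.single_add, ← shift_monMul]
  refine hψ _ (monMul_mem (p := fun j => j = i) (by rintro j rfl; exact hM) hf _ fun j hj => ?_)
  by_contra h
  simp [h] at hj

/-- A unit wandering vector that depends on `z_i` only has orthonormal monomial multiples. -/
theorem orthonormal_monMul {L : Submodule ℂ (HardySpace n)} {i : Fin n} {θ : HardySpace n}
    (hM : ∀ f ∈ L, shift i f ∈ L) (hθL : θ ∈ L) (h1 : ‖θ‖ = 1)
    (hθ : ∀ j, j ≠ i → backShift j θ = 0) (hw : ∀ f ∈ L, inner ℂ θ (shift i f) = 0) :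
    Orthonormal ℂ fun α => monMul α θ := by
  constructor
  · intro α
    rw [norm_eq_sqrt_re_inner (𝕜 := ℂ), inner_monMul_monMul, ← norm_eq_sqrt_re_inner, h1]
  · intro α β hne
    have hk : ∀ k, k ≠ 0 → inner ℂ θ (monMul (Pi.single i k) θ) = 0 :=
      fun k hk => inner_monMul_single hM hw hθL hk
    refine inner_monMul_eq_zero hθ hθ (fun k h => ?_) fun k h => hk k ?_
    · rw [← inner_conj_symm, hk k, map_zero]
      rintro rfl
      exact hne (by simpa using h)
    · rintro rfl
      exact hne (by simpa using h.symm)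

/-- If the functions `z ^ α θ` are orthonormal, then multiplication by `θ` is an isometry. -/
theorem exists_mul_isometry {θ : HardySpace n} (h : Orthonormal ℂ fun α => monMul α θ) :
    ∃ V : HardySpace n →ₗᵢ[ℂ] HardySpace n,
      (∀ f, HasSum (fun α => coeff f α • monMul α θ) (V f)) ∧
      ∀ f, ∀ z ∈ polydisc n, V f z = θ z * f z := by
  let V := h.orthogonalFamily.linearIsometry.comp (coeffEquiv n).toLinearIsometry
  have hV : ∀ f, HasSum (fun α => coeff f α • monMul α θ) (V f) := fun f =>
    h.orthogonalFamily.hasSum_linearIsometry (coeffEquiv n f)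
  refine ⟨V, hV, fun f z hz => ?_⟩
  obtain ⟨k, -, hk⟩ := exists_kernel hz
  have h1 := (innerSL ℂ k).hasSum (hV f)
  simp only [innerSL_apply_apply, inner_smul_right] at h1
  simp only [hk, monMul_apply] at h1
  refine h1.unique (((hasSum_coeff f hz).mul_left (θ z)).congr_fun fun α => ?_)
  ring

/-- A function that multiplies the Hardy space isometrically is bounded by `1`, since the adjoint
of the multiplication has the reproducing kernels as eigenvectors. -/
theorem norm_apply_le_one {θ : HardySpace n} {V : HardySpace n →ₗᵢ[ℂ] HardySpace n}
    (hV : ∀ f, ∀ z ∈ polydisc n, V f z = θ z * f z) {z : Fin n → ℂ} (hz : z ∈ polydisc n) :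
    ‖θ z‖ ≤ 1 := by
  obtain ⟨k, hk0, hk⟩ := exists_kernel hz
  have h1 : ‖inner ℂ k (V k)‖ ≤ ‖k‖ * ‖k‖ := by
    simpa using norm_inner_le_norm (𝕜 := ℂ) k (V k)
  rw [hk, hV k z hz, ← hk k, norm_mul, inner_self_eq_norm_sq_to_K] at h1
  have h2 : 0 < ‖k‖ * ‖k‖ := by have := norm_pos_iff.2 hk0; positivity
  refine le_of_mul_le_mul_right ?_ h2
  simpa [sq] using h1

/-- Two functions of `z_i` that multiply the Hardy space isometrically have products that are
not all orthogonal, because `θ ψ` is a multiple of both. -/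
theorem not_inner_monMul_eq_zero {θ ψ : HardySpace n}
    (hθ : Orthonormal ℂ fun α => monMul α θ) (hψ : Orthonormal ℂ fun α => monMul α ψ) :
    ¬ ∀ α β, inner ℂ (monMul α θ) (monMul β ψ) = 0 := by
  intro h
  obtain ⟨V, hV, hV'⟩ := exists_mul_isometry hθ
  obtain ⟨W, hW, hW'⟩ := exists_mul_isometry hψ
  have hVW : V ψ = W θ := HardySpace.ext fun z hz => by rw [hV' _ z hz, hW' _ z hz, mul_comm]
  have h1 : ∀ α, inner ℂ (monMul α θ) (W θ) = 0 := fun α => by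
    have := (innerSL ℂ (monMul α θ)).hasSum (hW θ)
    simp only [innerSL_apply_apply, inner_smul_right, h, mul_zero] at this
    exact this.unique hasSum_zero
  have h2 := (innerSL ℂ (W θ)).hasSum (hV ψ)
  simp only [innerSL_apply_apply, inner_smul_right, hVW] at h2
  have h3 : inner ℂ (W θ) (W θ) = 0 := h2.unique <| by
    convert hasSum_zero with α
    rw [← inner_conj_symm, h1, map_zero, mul_zero]
  rw [inner_self_eq_zero, map_eq_zero_iff _ W.injective] at h3
  have : ‖monMul 0 θ‖ = 1 := hθ.1 0
  rw [monMul_zero, h3, norm_zero] at this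
  exact zero_ne_one this

/-- A closed subspace that is invariant under all shifts and reduces all of them but `M_{z_i}`
equals `θ H²` for some `θ` in it that depends on `z_i` only and multiplies isometrically. -/
theorem exists_generator {S : Submodule ℂ (HardySpace n)} {i : Fin n}
    (hc : IsClosed (S : Set (HardySpace n))) (hM : ∀ j, ∀ f ∈ S, shift j f ∈ S)
    (hB : ∀ j, j ≠ i → ∀ f ∈ S, backShift j f ∈ S) (hS : S ≠ ⊥) :
    ∃ θ : HardySpace n, ‖θ‖ = 1 ∧ (∀ j, j ≠ i → backShift j θ = 0) ∧
      ∃ V : HardySpace n →ₗᵢ[ℂ] HardySpace n, (∀ f, ∀ z ∈ polydisc n, V f z = θ z * f z) ∧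
        ∀ f, f ∈ S ↔ ∃ g, V g = f := by
  -- `K` consists of the functions in `S` that depend on `z_i` only.
  let K : Submodule ℂ (HardySpace n) :=
    S ⊓ ⨅ (j : Fin n) (_ : j ≠ i), (backShift j).toLinearMap.ker
  have hK : ∀ f, f ∈ K ↔ f ∈ S ∧ ∀ j, j ≠ i → backShift j f = 0 := fun f => by
    simp [K, Submodule.mem_iInf]
  have hKM : ∀ f ∈ K, shift i f ∈ K := fun f hf => by
    rw [hK] at hf ⊢
    exact ⟨hM i f hf.1, fun j hj => by rw [backShift_shift_comm hj, hf.2 j hj, map_zero]⟩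
  have hKc : IsClosed (K : Set (HardySpace n)) := by
    have : (K : Set (HardySpace n)) =
        (S : Set (HardySpace n)) ∩ ⋂ (j : Fin n) (_ : j ≠ i), {f | backShift j f = 0} := by
      ext f; simp [hK]
    rw [this]
    exact hc.inter (isClosed_iInter fun j => isClosed_iInter fun _ =>
      isClosed_eq (backShift j).continuous continuous_const)
  have hK0 : K ≠ ⊥ := by
    obtain ⟨f, hf, h0, hj⟩ := exists_backShift_eq_zero (s := Finset.univ.erase i)
      (fun j _ => hM j) (fun j hj => hB j (Finset.ne_of_mem_erase hj)) hS
    exact K.ne_bot_iff.2 ⟨f, (hK f).2 ⟨hf, fun j hj' => hj j (by simp [hj'])⟩, h0⟩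
  obtain ⟨θ, hθK, hθ1, hθw⟩ := exists_wandering hKc hKM hK0
  have hθ0 := ((hK θ).1 hθK).2
  have hθo := orthonormal_monMul hKM hθK hθ1 hθ0 hθw
  obtain ⟨V, hV, hV'⟩ := exists_mul_isometry hθo
  have hVS : ∀ g, V g ∈ S := fun g => hc.mem_of_tendsto (hV g) <| Eventually.of_forall fun s =>
    S.sum_mem fun α _ => S.smul_mem _ <| monMul_mem (p := fun _ => True) (fun j _ => hM j)
      ((hK θ).1 hθK).1 α fun _ _ => trivial
  -- `L` consists of the functions in `K` orthogonal to `θ H²`.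
  let L : Submodule ℂ (HardySpace n) :=
    K ⊓ ⨅ k : ℕ, (innerSL ℂ (monMul (Pi.single i k) θ)).toLinearMap.ker
  have hL : ∀ f, f ∈ L ↔ f ∈ K ∧ ∀ k, inner ℂ (monMul (Pi.single i k) θ) f = 0 := fun f => by
    simp [L, Submodule.mem_iInf]
  have hLM : ∀ f ∈ L, shift i f ∈ L := fun f hf => by
    rw [hL] at hf ⊢
    refine ⟨hKM f hf.1, fun k => ?_⟩
    cases k with
    | zero => rw [Pi.single_zero, monMul_zero]; exact hθw f hf.1
    | succ k => rw [Pi.single_add, ← shift_monMul, inner_shift_shift]; exact hf.2 k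
  have hLc : IsClosed (L : Set (HardySpace n)) := by
    have : (L : Set (HardySpace n)) =
        (K : Set (HardySpace n)) ∩ ⋂ k : ℕ, {f | inner ℂ (monMul (Pi.single i k) θ) f = 0} := by
      ext f; simp [hL]
    rw [this]
    exact hKc.inter (isClosed_iInter fun k =>
      isClosed_eq (innerSL ℂ (monMul (Pi.single i k) θ)).continuous continuous_const)
  have hL0 : L = ⊥ := by
    by_contra hne
    obtain ⟨ψ, hψL, hψ1, hψw⟩ := exists_wandering hLc hLM hne
    have hψK := ((hL ψ).1 hψL).1
    have hψ0 := ((hK ψ).1 hψK).2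
    refine not_inner_monMul_eq_zero hθo (orthonormal_monMul hLM hψL hψ1 hψ0 hψw) fun α β => ?_
    refine inner_monMul_eq_zero hθ0 hψ0 (fun k _ => ((hL ψ).1 hψL).2 k) fun k _ => ?_
    rcases eq_or_ne k 0 with rfl | hk
    · simpa [monMul_zero] using ((hL ψ).1 hψL).2 0
    · exact inner_monMul_single hKM hθw hψK hk
  -- The orthogonal complement of `θ H²` in `S` reduces `M_{z_j}` for `j ≠ i`, so that it would
  -- contain an element of `L` if it were nonzero.
  let T : Submodule ℂ (HardySpace n) :=
    S ⊓ ⨅ α : Fin n → ℕ, (innerSL ℂ (monMul α θ)).toLinearMap.ker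
  have hT : ∀ f, f ∈ T ↔ f ∈ S ∧ ∀ α, inner ℂ (monMul α θ) f = 0 := fun f => by
    simp [T, Submodule.mem_iInf]
  have hT0 : T = ⊥ := by
    by_contra hne
    obtain ⟨f, hf, h0, hj⟩ := exists_backShift_eq_zero (s := Finset.univ.erase i) (S := T)
      (fun j hj f hf => by
        rw [hT] at hf ⊢
        refine ⟨hM j f hf.1, fun α => ?_⟩
        by_cases hα : α j = 0
        · rw [← ContinuousLinearMap.adjoint_inner_left]
          have : backShift j (monMul α θ) = 0 := ext_coeff fun β => by
            rw [coeff_backShift, coeff_monMul, coeff_zero]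
            split_ifs with hle
            · exact coeff_eq_zero_of_backShift (hθ0 j (Finset.ne_of_mem_erase hj)) (by simp [hα])
            · rfl
          rw [this, inner_zero_left]
        · obtain ⟨β, rfl⟩ := exists_eq_add_single hα
          rw [← shift_monMul, inner_shift_shift, hf.2])
      (fun j hj f hf => by
        rw [hT] at hf ⊢
        refine ⟨hB j (Finset.ne_of_mem_erase hj) f hf.1, fun α => ?_⟩
        rw [ContinuousLinearMap.adjoint_inner_right, shift_monMul, hf.2]) hne
    have hfL : f ∈ L := (hL f).2 ⟨(hK f).2 ⟨((hT f).1 hf).1, fun j hj' => hj j (by simp [hj'])⟩,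
      fun k => ((hT f).1 hf).2 _⟩
    rw [hL0] at hfL
    exact h0 hfL
  refine ⟨θ, hθ1, hθ0, V, hV', fun f => ⟨fun hf => ?_, ?_⟩⟩
  · let N : Submodule ℂ (HardySpace n) := V.toLinearMap.range
    have hN : IsClosed (N : Set (HardySpace n)) := V.isometry.isClosedEmbedding.isClosed_range
    have : CompleteSpace N := hN.completeSpace_coe
    have hNS : N ≤ S := by
      rintro _ ⟨g, rfl⟩
      exact hVS g
    have hmem := N.starProjection_apply_mem f
    have hmon : ∀ α, monMul α θ ∈ N := fun α => by
      obtain ⟨e, he, -⟩ := exists_coeff_eq_inner α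
      refine ⟨e, (hV e).unique ?_⟩
      have := hasSum_single (f := fun β => coeff e β • monMul β θ) α fun β hβ => by simp [he, hβ]
      simpa [he] using this
    have hg : f - N.starProjection f ∈ T := (hT _).2 ⟨S.sub_mem hf (hNS hmem), fun α =>
      (N.mem_orthogonal _).1 (N.sub_starProjection_mem_orthogonal f) _ (hmon α)⟩
    rw [hT0, Submodule.mem_bot, sub_eq_zero] at hg
    rw [← hg] at hmem
    exact hmem
  · rintro ⟨g, rfl⟩
    exact hVS g

/-! ### Radial limits on the circle -/

theorem volume_eq_haarAddCircle :
    (volume : Measure UnitAddCircle) = AddCircle.haarAddCircle := by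
  rw [AddCircle.volume_eq_smul_haarAddCircle, ENNReal.ofReal_one, one_smul]

/-- Jordan's inequality for chords of the circle. -/
theorem four_mul_norm_le (u : UnitAddCircle) : 4 * ‖u‖ ≤ ‖(u.toCircle : ℂ) - 1‖ := by
  obtain ⟨x, rfl⟩ := QuotientAddGroup.mk_surjective u
  -- Choose the representative of smallest absolute value.
  have hx : ((x - round x : ℝ) : UnitAddCircle) = (x : UnitAddCircle) := by
    rw [AddCircle.coe_sub, sub_eq_self]
    exact (AddCircle.coe_eq_zero_iff 1).2 ⟨round x, by simp⟩
  change 4 * ‖(x : UnitAddCircle)‖ ≤ ‖((AddCircle.toCircle (x : UnitAddCircle) : Circle) : ℂ) - 1‖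
  rw [UnitAddCircle.norm_eq, ← hx, AddCircle.toCircle_apply_mk, Circle.coe_exp]
  have h2 := abs_sub_round x
  set y := x - round x with hy
  have h3 := Real.mul_abs_le_abs_sin (x := Real.pi * y) (by
    rw [abs_mul, abs_of_pos Real.pi_pos]; nlinarith [Real.pi_pos])
  have h4 : 2 / Real.pi * |Real.pi * y| = 2 * |y| := by
    rw [abs_mul, abs_of_pos Real.pi_pos]; field_simp
  rw [h4] at h3
  have h5 := Complex.norm_exp_I_mul_ofReal_sub_one (2 * Real.pi / 1 * y)
  rw [mul_comm Complex.I] at h5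
  rw [h5, norm_mul, Real.norm_eq_abs, Real.norm_eq_abs, abs_two,
    show 2 * Real.pi / 1 * y / 2 = Real.pi * y by ring]
  linarith

/-- The Poisson kernel on the unit circle, for the point `r e^{2πix}`. -/
abbrev circlePoisson (r : ℝ) (x s : UnitAddCircle) : ℝ :=
  poissonKernel 0 (r * (x.toCircle : ℂ)) (s.toCircle : ℂ)

theorem one_sub_le_norm_toCircle_sub {r : ℝ} (h0 : 0 ≤ r) (x s : UnitAddCircle) :
    1 - r ≤ ‖(s.toCircle : ℂ) - r * (x.toCircle : ℂ)‖ := by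
  have := norm_sub_norm_le (s.toCircle : ℂ) (r * (x.toCircle : ℂ))
  simpa [abs_of_nonneg h0, Circle.norm_coe] using this

theorem two_mul_dist_le {r : ℝ} (h0 : 0 ≤ r) (h1 : r ≤ 1) (x s : UnitAddCircle) :
    2 * dist s x ≤ ‖(s.toCircle : ℂ) - r * (x.toCircle : ℂ)‖ := by
  have h := four_mul_norm_le (s - x)
  have h2 : ‖((s - x).toCircle : ℂ) - 1‖ = ‖(s.toCircle : ℂ) - x.toCircle‖ := by
    have : (s.toCircle : ℂ) - x.toCircle = (((s - x).toCircle : ℂ) - 1) * x.toCircle := by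
      rw [sub_mul, one_mul, ← Circle.coe_mul, ← AddCircle.toCircle_add, sub_add_cancel]
    rw [this, norm_mul, Circle.norm_coe, mul_one]
  have h3 : ‖(s.toCircle : ℂ) - x.toCircle‖ ≤
      ‖(s.toCircle : ℂ) - r * (x.toCircle : ℂ)‖ + (1 - r) := by
    have h4 := norm_add_le ((s.toCircle : ℂ) - r * (x.toCircle : ℂ)) ((r - 1) * (x.toCircle : ℂ))
    have h5 : ‖((r : ℂ) - 1) * (x.toCircle : ℂ)‖ = 1 - r := by
      rw [norm_mul, Circle.norm_coe, mul_one, ← Complex.ofReal_one, ← Complex.ofReal_sub,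
        Complex.norm_real, Real.norm_eq_abs, abs_sub_comm, abs_of_nonneg (by linarith)]
    rw [h5] at h4
    refine le_of_eq_of_le (congrArg _ ?_) h4
    ring
  have h6 := one_sub_le_norm_toCircle_sub h0 x s
  rw [← dist_eq_norm] at h
  linarith

theorem circlePoisson_nonneg {r : ℝ} (h0 : 0 ≤ r) (h1 : r < 1) (x s : UnitAddCircle) :
    0 ≤ circlePoisson r x s := by
  rw [circlePoisson, poissonKernel_def]
  refine div_nonneg ?_ (by positivity)
  simp only [sub_zero, Circle.norm_coe, norm_mul, Complex.norm_real, Real.norm_eq_abs, sq_abs,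
    mul_one]
  nlinarith

theorem continuous_circlePoisson {r : ℝ} (h0 : 0 ≤ r) (h1 : r < 1) (x : UnitAddCircle) :
    Continuous (circlePoisson r x) := by
  unfold circlePoisson poissonKernel
  have hc : Continuous fun s : UnitAddCircle => (s.toCircle : ℂ) :=
    continuous_subtype_val.comp AddCircle.continuous_toCircle
  simp only [sub_zero]
  refine ((hc.norm.pow 2).sub continuous_const).div ((hc.sub continuous_const).norm.pow 2) ?_
  intro s
  have := one_sub_le_norm_toCircle_sub h0 x s
  exact pow_ne_zero _ (by linarith)

/-- The Poisson kernel is dominated by a combination of normalized indicators of dyadic balls. -/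
theorem circlePoisson_le {r : ℝ} (h0 : 0 ≤ r) (h1 : r < 1) (x s : UnitAddCircle) {N : ℕ}
    (hN : 1 / 2 ≤ 2 ^ N * (1 - r)) :
    circlePoisson r x s ≤ ∑ k ∈ Finset.range (N + 1),
      (Metric.closedBall x (2 ^ k * (1 - r))).indicator (fun _ => 2 / (4 ^ k * (1 - r))) s := by
  have hδ : 0 < 1 - r := by linarith
  have hd : dist s x ≤ 2 ^ N * (1 - r) := by
    have := AddCircle.norm_le_half_period (1 : ℝ) (x := s - x) one_ne_zero
    rw [← dist_eq_norm, abs_one] at this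
    linarith
  have hex : ∃ k, dist s x ≤ 2 ^ k * (1 - r) := ⟨N, hd⟩
  classical
  set k := Nat.find hex with hk
  have hkN : k ≤ N := Nat.find_min' hex hd
  have hks : dist s x ≤ 2 ^ k * (1 - r) := Nat.find_spec hex
  refine le_trans ?_ (Finset.single_le_sum (f := fun k => (Metric.closedBall x
    (2 ^ k * (1 - r))).indicator (fun _ => 2 / (4 ^ k * (1 - r))) s)
    (fun l _ => Set.indicator_nonneg (fun _ _ => by positivity) _)
    (Finset.mem_range.2 (Nat.lt_succ_of_le hkN)))
  rw [Set.indicator_of_mem (Metric.mem_closedBall.2 hks)]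
  -- Both lower bounds for the denominator combine to `2 ^ k (1 - r)`.
  have hlow : 2 ^ k * (1 - r) ≤ ‖(s.toCircle : ℂ) - r * (x.toCircle : ℂ)‖ := by
    rcases Nat.eq_zero_or_pos k with h | h
    · rw [h, pow_zero, one_mul]
      exact one_sub_le_norm_toCircle_sub h0 x s
    · have h2 := Nat.find_min hex (m := k - 1) (by omega)
      have h3 : (2 : ℝ) ^ k = 2 * 2 ^ (k - 1) := by
        rw [← pow_succ']; congr 1; omega
      rw [h3]
      have := two_mul_dist_le h0 h1.le x s
      push Not at h2
      linarith
  have hsq : (2 ^ k * (1 - r)) ^ 2 ≤ ‖(s.toCircle : ℂ) - r * (x.toCircle : ℂ)‖ ^ 2 := by gcongr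
  rw [circlePoisson, poissonKernel_def]
  simp only [sub_zero, Circle.norm_coe, norm_mul, Complex.norm_real, Real.norm_eq_abs, sq_abs,
    mul_one, one_pow]
  have h4 : (4 : ℝ) ^ k = (2 ^ k) ^ 2 := by rw [← pow_mul, mul_comm, pow_mul]; norm_num
  calc (1 - r ^ 2) / ‖(s.toCircle : ℂ) - r * (x.toCircle : ℂ)‖ ^ 2
      ≤ (2 * (1 - r)) / (2 ^ k * (1 - r)) ^ 2 := by
        refine div_le_div₀ (by positivity) (by nlinarith) (by positivity) hsq
    _ = 2 / (4 ^ k * (1 - r)) := by rw [h4]; field_simp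

/-- The Poisson integral of the boundary values `z ^ k`. -/
theorem integral_circlePoisson_mul {r : ℝ} (h0 : 0 ≤ r) (h1 : r < 1) (x : UnitAddCircle) (k : ℕ) :
    ∫ s, (circlePoisson r x s : ℂ) * (s.toCircle : ℂ) ^ k ∂AddCircle.haarAddCircle =
      (r * (x.toCircle : ℂ)) ^ k := by
  have h := (show DiffContOnCl ℂ (fun z : ℂ => z ^ k) (Metric.ball 0 1) from
    (differentiable_id.pow k).diffContOnCl).circleAverage_poissonKernel_smul
    (w := r * (x.toCircle : ℂ)) (by simpa [abs_of_nonneg h0, Circle.norm_coe] using h1)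
  rw [← h, ← volume_eq_haarAddCircle, ← UnitAddCircle.intervalIntegral_preimage 0,
    Real.circleAverage_def]
  have h2 := intervalIntegral.integral_comp_mul_left (a := 0) (b := 1) (c := 2 * Real.pi)
    (fun θ => (poissonKernel 0 (r * (x.toCircle : ℂ)) • fun z : ℂ => z ^ k) (circleMap 0 1 θ))
    Real.two_pi_pos.ne'
  rw [mul_zero, mul_one] at h2
  rw [zero_add, ← h2]
  refine intervalIntegral.integral_congr fun t _ => ?_
  have ht : circleMap 0 1 (2 * Real.pi * t) = (AddCircle.toCircle (t : UnitAddCircle) : ℂ) := by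
    rw [AddCircle.toCircle_apply_mk, Circle.coe_exp, circleMap]
    simp
  simp only [ht, Pi.smul_apply', Complex.real_smul]

theorem integral_circlePoisson {r : ℝ} (h0 : 0 ≤ r) (h1 : r < 1) (x : UnitAddCircle) :
    ∫ s, circlePoisson r x s ∂AddCircle.haarAddCircle = 1 := by
  have h := integral_circlePoisson_mul h0 h1 x 0
  simp only [pow_zero, mul_one] at h
  exact_mod_cast (integral_complex_ofReal (f := circlePoisson r x)).symm.trans h

/-- The dyadic averages of a function of `ρ` that is bounded and of order `o(ρ)` at `0`. -/
theorem tendsto_tsum_dyadic {F : ℝ → ℝ} {A : ℝ} (hF0 : ∀ ρ, 0 ≤ F ρ) (hFA : ∀ ρ, F ρ ≤ A)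
    (hF : Tendsto (fun ρ => F ρ / ρ) (𝓝[>] 0) (𝓝 0)) :
    (∀ δ > 0, Summable fun k : ℕ => 2 / (4 ^ k * δ) * F (2 ^ k * δ)) ∧
    Tendsto (fun δ => ∑' k : ℕ, 2 / (4 ^ k * δ) * F (2 ^ k * δ)) (𝓝[>] 0) (𝓝 0) := by
  obtain ⟨C, hC⟩ : ∃ C, ∀ ρ > 0, F ρ / ρ ≤ C := by
    have h1 : ∀ᶠ ρ in 𝓝[>] (0 : ℝ), F ρ / ρ < 1 := hF.eventually (gt_mem_nhds one_pos)
    obtain ⟨ρ₀, hρ₀, h⟩ := mem_nhdsGT_iff_exists_Ioo_subset.1 h1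
    rw [Set.mem_Ioi] at hρ₀
    refine ⟨max 1 (A / ρ₀), fun ρ hρ => ?_⟩
    rcases lt_or_ge ρ ρ₀ with hlt | hge
    · exact le_max_of_le_left (h ⟨hρ, hlt⟩ : F ρ / ρ < 1).le
    · exact le_max_of_le_right (div_le_div₀ ((hF0 ρ).trans (hFA ρ)) (hFA ρ) hρ₀ hge)
  have heq : ∀ δ > 0, ∀ k : ℕ, 2 / (4 ^ k * δ) * F (2 ^ k * δ) =
      2 * (1 / 2) ^ k * (F (2 ^ k * δ) / (2 ^ k * δ)) := by
    intro δ hδ k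
    have h4 : (4 : ℝ) ^ k = 2 ^ k * 2 ^ k := by rw [← mul_pow]; norm_num
    rw [h4, one_div, inv_pow]
    field_simp
  have hs : Summable fun k : ℕ => 2 * (1 / 2 : ℝ) ^ k * C :=
    (summable_geometric_two.mul_left 2).mul_right C
  have hle : ∀ δ > 0, ∀ k : ℕ, ‖2 / (4 ^ k * δ) * F (2 ^ k * δ)‖ ≤ 2 * (1 / 2 : ℝ) ^ k * C := by
    intro δ hδ k
    have := hF0 (2 ^ k * δ)
    rw [heq δ hδ, Real.norm_of_nonneg (by positivity)]
    exact mul_le_mul_of_nonneg_left (hC _ (by positivity)) (by positivity)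
  refine ⟨fun δ hδ => Summable.of_norm_bounded hs (hle δ hδ), ?_⟩
  have := tendsto_tsum_of_dominated_convergence (𝓕 := 𝓝[>] (0 : ℝ))
    (f := fun δ (k : ℕ) => 2 / (4 ^ k * δ) * F (2 ^ k * δ)) (g := fun _ => 0) hs (fun k => ?_)
    (by filter_upwards [self_mem_nhdsWithin] with δ hδ using hle δ hδ)
  · simpa using this
  · have h2 : Tendsto (fun δ : ℝ => 2 ^ k * δ) (𝓝[>] 0) (𝓝[>] 0) := by
      refine tendsto_nhdsWithin_iff.2 ⟨?_, ?_⟩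
      · have : Tendsto (fun δ : ℝ => 2 ^ k * δ) (𝓝 0) (𝓝 (2 ^ k * 0)) :=
          (continuous_const.mul continuous_id).tendsto 0
        rw [mul_zero] at this
        exact this.mono_left nhdsWithin_le_nhds
      · filter_upwards [self_mem_nhdsWithin] with δ hδ
        have : 0 < δ := hδ
        exact Set.mem_Ioi.2 (by positivity)
    have h3 := (hF.comp h2).const_mul (2 * (1 / 2 : ℝ) ^ k)
    rw [mul_zero] at h3
    refine h3.congr' ?_
    filter_upwards [self_mem_nhdsWithin] with δ hδ using (heq δ hδ k).symm

/-- At a Lebesgue point, integrals over shrinking balls are small compared with the radius. -/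
theorem ae_tendsto_setIntegral_div {φ : UnitAddCircle → ℂ}
    (hφ : Integrable φ AddCircle.haarAddCircle) : ∀ᵐ x ∂AddCircle.haarAddCircle,
    Tendsto (fun ρ => (∫ s in Metric.closedBall x ρ, ‖φ s - φ x‖ ∂AddCircle.haarAddCircle) / ρ)
      (𝓝[>] 0) (𝓝 0) := by
  rw [← volume_eq_haarAddCircle] at hφ ⊢
  filter_upwards [IsUnifLocDoublingMeasure.ae_tendsto_average_norm_sub (μ := volume)
    hφ.locallyIntegrable 1] with x hx
  have h := hx (fun _ => x) (fun ρ : ℝ => ρ) (l := 𝓝[>] 0) tendsto_id (by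
    filter_upwards [self_mem_nhdsWithin] with ρ hρ
    exact Metric.mem_closedBall_self (by simpa using (Set.mem_Ioi.1 hρ).le))
  have h2 := h.const_mul 2
  rw [mul_zero] at h2
  refine h2.congr' ?_
  filter_upwards [Ioo_mem_nhdsGT (show (0 : ℝ) < 1 / 2 by norm_num)] with ρ hρ
  have hv : volume.real (Metric.closedBall x ρ) = 2 * ρ := by
    rw [Measure.real, AddCircle.volume_closedBall, ENNReal.toReal_ofReal,
      min_eq_right (by linarith [hρ.2])]
    exact le_min zero_le_one (by linarith [hρ.1])
  rw [setAverage_eq, hv, smul_eq_mul]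
  have := hρ.1
  field_simp

/-- **Fatou's theorem**: Poisson integrals converge radially almost everywhere. -/
theorem ae_tendsto_integral_circlePoisson {φ : UnitAddCircle → ℂ}
    (hφ : Integrable φ AddCircle.haarAddCircle) : ∀ᵐ x ∂AddCircle.haarAddCircle,
    Tendsto (fun r => ∫ s, (circlePoisson r x s : ℂ) * φ s ∂AddCircle.haarAddCircle)
      (𝓝[<] 1) (𝓝 (φ x)) := by
  filter_upwards [ae_tendsto_setIntegral_div hφ] with x hx
  set g : UnitAddCircle → ℝ := fun s => ‖φ s - φ x‖ with hg
  have hgi : Integrable g AddCircle.haarAddCircle := (hφ.sub (integrable_const _)).norm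
  have hg0 : ∀ s, 0 ≤ g s := fun s => norm_nonneg _
  obtain ⟨hs, ht⟩ := tendsto_tsum_dyadic
    (F := fun ρ => ∫ s in Metric.closedBall x ρ, g s ∂AddCircle.haarAddCircle)
    (fun ρ => integral_nonneg hg0)
    (fun ρ => setIntegral_le_integral hgi (Eventually.of_forall hg0)) hx
  have hδ : Tendsto (fun r : ℝ => 1 - r) (𝓝[<] 1) (𝓝[>] 0) := by
    refine tendsto_nhdsWithin_iff.2 ⟨?_, ?_⟩
    · have : Tendsto (fun r : ℝ => 1 - r) (𝓝 1) (𝓝 (1 - 1)) :=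
        (continuous_const.sub continuous_id).tendsto 1
      rw [sub_self] at this
      exact this.mono_left nhdsWithin_le_nhds
    · filter_upwards [self_mem_nhdsWithin] with r hr
      exact Set.mem_Ioi.2 (sub_pos.2 hr)
  rw [tendsto_iff_norm_sub_tendsto_zero]
  refine squeeze_zero' (Eventually.of_forall fun _ => norm_nonneg _) ?_ (ht.comp hδ)
  filter_upwards [Ico_mem_nhdsLT (zero_lt_one (α := ℝ))] with r ⟨h0, h1⟩
  have hδ0 : 0 < 1 - r := by linarith
  have hc := continuous_circlePoisson h0 h1 x
  obtain ⟨B, hB⟩ := isCompact_univ.exists_bound_of_continuousOn hc.continuousOn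
  have hPi : ∀ {E : Type} [NormedAddCommGroup E] [NormedSpace ℝ E] {u : UnitAddCircle → E},
      Integrable u AddCircle.haarAddCircle →
      Integrable (fun s => circlePoisson r x s • u s) AddCircle.haarAddCircle := fun hu =>
    hu.bdd_smul B hc.aestronglyMeasurable (Eventually.of_forall fun s => hB s trivial)
  have hPφ := hPi hφ
  have hP1 := hPi (integrable_const (φ x))
  simp only [Complex.real_smul] at hPφ hP1
  have hsub : (∫ s, (circlePoisson r x s : ℂ) * φ s ∂AddCircle.haarAddCircle) - φ x =
      ∫ s, (circlePoisson r x s : ℂ) * (φ s - φ x) ∂AddCircle.haarAddCircle := by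
    simp only [mul_sub]
    rw [integral_sub hPφ hP1, integral_mul_const, integral_complex_ofReal,
      integral_circlePoisson h0 h1, Complex.ofReal_one, one_mul]
  obtain ⟨N, hN⟩ : ∃ N : ℕ, 1 / 2 ≤ 2 ^ N * (1 - r) := by
    obtain ⟨N, hN⟩ := pow_unbounded_of_one_lt (1 / 2 / (1 - r)) one_lt_two
    exact ⟨N, ((div_lt_iff₀ hδ0).1 hN).le⟩
  have hind : ∀ k ∈ Finset.range (N + 1), Integrable (fun s =>
      (Metric.closedBall x (2 ^ k * (1 - r))).indicator (fun s => 2 / (4 ^ k * (1 - r)) * g s) s)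
      AddCircle.haarAddCircle := fun k _ =>
    (hgi.const_mul _).indicator Metric.isClosed_closedBall.measurableSet
  calc ‖(∫ s, (circlePoisson r x s : ℂ) * φ s ∂AddCircle.haarAddCircle) - φ x‖
      ≤ ∫ s, circlePoisson r x s * g s ∂AddCircle.haarAddCircle := by
        rw [hsub]
        refine (norm_integral_le_integral_norm _).trans_eq (integral_congr_ae ?_)
        refine Eventually.of_forall fun s => ?_
        simp only [norm_mul, Complex.norm_real, hg]
        rw [Real.norm_of_nonneg (circlePoisson_nonneg h0 h1 x s)]
    _ ≤ ∫ s, ∑ k ∈ Finset.range (N + 1), (Metric.closedBall x (2 ^ k * (1 - r))).indicator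
          (fun s => 2 / (4 ^ k * (1 - r)) * g s) s ∂AddCircle.haarAddCircle := by
        refine integral_mono (hPi hgi) (integrable_finsetSum _ hind) fun s => ?_
        refine (mul_le_mul_of_nonneg_right (circlePoisson_le h0 h1 x s hN) (hg0 s)).trans_eq ?_
        rw [Finset.sum_mul]
        refine Finset.sum_congr rfl fun k _ => ?_
        by_cases hs : s ∈ Metric.closedBall x (2 ^ k * (1 - r))
        · rw [Set.indicator_of_mem hs, Set.indicator_of_mem hs]
        · rw [Set.indicator_of_notMem hs, Set.indicator_of_notMem hs, zero_mul]
    _ = ∑ k ∈ Finset.range (N + 1), 2 / (4 ^ k * (1 - r)) *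
          ∫ s in Metric.closedBall x (2 ^ k * (1 - r)), g s ∂AddCircle.haarAddCircle := by
        rw [integral_finsetSum _ hind]
        refine Finset.sum_congr rfl fun k _ => ?_
        rw [integral_indicator Metric.isClosed_closedBall.measurableSet, integral_const_mul]
    _ ≤ _ := (hs _ hδ0).sum_le_tsum _ fun k _ =>
        mul_nonneg (by positivity) (integral_nonneg hg0)

/-- A power series with square-summable coefficients has radial limits almost everywhere; they
form an `L²` function on the circle with the same norm. -/
theorem exists_radial_limit {a : ℕ → ℂ} (ha : Summable fun k => ‖a k‖ ^ 2) :
    ∃ φ : UnitAddCircle → ℂ, MemLp φ 2 AddCircle.haarAddCircle ∧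
      ∫ t, ‖φ t‖ ^ 2 ∂AddCircle.haarAddCircle = ∑' k, ‖a k‖ ^ 2 ∧
      ∀ᵐ t ∂AddCircle.haarAddCircle, Tendsto (fun r : ℝ => ∑' k, a k * (r * (t.toCircle : ℂ)) ^ k)
        (𝓝[<] 1) (𝓝 (φ t)) := by
  let A : lp (fun _ : ℕ => ℂ) 2 := ⟨a, (memℓp_gen_iff (by norm_num)).2 (by simpa using ha)⟩
  have ho : Orthonormal ℂ fun k : ℕ => fourierLp (T := 1) 2 (k : ℤ) :=
    orthonormal_fourier.comp _ Nat.cast_injective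
  let Φ := ho.orthogonalFamily.linearIsometry A
  have hΦ : HasSum (fun k : ℕ => a k • fourierLp (T := 1) 2 (k : ℤ)) Φ :=
    ho.orthogonalFamily.hasSum_linearIsometry A
  have hmem : MemLp Φ 2 AddCircle.haarAddCircle := Lp.memLp Φ
  refine ⟨Φ, hmem, ?_, ?_⟩
  · have h1 : ‖Φ‖ = ‖A‖ := LinearIsometry.norm_map _ A
    have h2 := lp.norm_rpow_eq_tsum (p := 2) (by norm_num) A
    simp only [ENNReal.toReal_ofNat, Real.rpow_ofNat] at h2
    have h3 := MeasureTheory.L2.inner_def (𝕜 := ℂ) Φ Φ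
    rw [inner_self_eq_norm_sq_to_K, h1] at h3
    have h4 : ∀ t, inner ℂ (Φ t) (Φ t) = ((‖Φ t‖ ^ 2 : ℝ) : ℂ) := fun t => by
      rw [inner_self_eq_norm_sq_to_K]; simp
    simp only [h4] at h3
    rw [integral_complex_ofReal] at h3
    have h5 : ‖A‖ ^ 2 = ∫ t, ‖Φ t‖ ^ 2 ∂AddCircle.haarAddCircle := Complex.ofReal_injective (by simpa using h3)
    rw [← h5, h2]
  · filter_upwards [ae_tendsto_integral_circlePoisson (hmem.integrable one_le_two)] with x hx
    refine hx.congr' ?_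
    filter_upwards [Ico_mem_nhdsLT (zero_lt_one (α := ℝ))] with r ⟨h0, h1⟩
    let P : C(UnitAddCircle, ℂ) := ⟨fun s => (circlePoisson r x s : ℂ),
      Complex.continuous_ofReal.comp (continuous_circlePoisson h0 h1 x)⟩
    let p := ContinuousMap.toLp (E := ℂ) 2 (AddCircle.haarAddCircle (T := 1)) ℂ P
    have h2 := (innerSL ℂ p).hasSum hΦ
    simp only [innerSL_apply_apply, inner_smul_right] at h2
    have h3 : inner ℂ p Φ = ∫ s, (circlePoisson r x s : ℂ) * Φ s ∂AddCircle.haarAddCircle := by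
      rw [MeasureTheory.L2.inner_def]
      refine integral_congr_ae ?_
      filter_upwards [ContinuousMap.coeFn_toLp (p := 2) (𝕜 := ℂ) AddCircle.haarAddCircle P]
        with s hs
      rw [hs]
      simp [P, mul_comm]
    have h4 : ∀ k : ℕ, inner ℂ p (fourierLp (T := 1) 2 (k : ℤ)) = (r * (x.toCircle : ℂ)) ^ k := by
      intro k
      rw [← integral_circlePoisson_mul h0 h1 x k]
      simp only [p, fourierLp]
      rw [ContinuousMap.inner_toLp]
      refine integral_congr_ae (Eventually.of_forall fun s => ?_)
      simp [P, fourier_apply, AddCircle.toCircle_nsmul, mul_comm]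
    simp only [h4, h3] at h2
    exact h2.tsum_eq.symm

/-! ### Inner functions of one variable -/

/-- For a function of `z_i`, sums over all Taylor coefficients reduce to those of powers of
`z_i`. -/
theorem hasSum_single_iff {i : Fin n} {θ : HardySpace n} (hθ : ∀ j, j ≠ i → backShift j θ = 0)
    {M : Type*} [AddCommMonoid M] [TopologicalSpace M] {F : (Fin n → ℕ) → ℂ → M}
    (hF : ∀ α, F α 0 = 0) {s : M} :
    HasSum (fun k : ℕ => F (Pi.single i k) (coeff θ (Pi.single i k))) s ↔
      HasSum (fun α => F α (coeff θ α)) s := by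
  refine (Pi.single_injective (M := fun _ : Fin n => ℕ) i).hasSum_iff
    (f := fun α => F α (coeff θ α)) fun α hα => ?_
  obtain ⟨j, hj, hαj⟩ : ∃ j, j ≠ i ∧ α j ≠ 0 := by
    by_contra! h
    refine hα ⟨α i, funext fun j => ?_⟩
    rcases eq_or_ne j i with rfl | hj
    · simp
    · simp [hj, h j hj]
  rw [coeff_eq_zero_of_backShift (hθ j hj) hαj, hF]

theorem hasSum_pow {i : Fin n} {θ : HardySpace n} (hθ : ∀ j, j ≠ i → backShift j θ = 0)
    {z : Fin n → ℂ} (hz : z ∈ polydisc n) :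
    HasSum (fun k : ℕ => coeff θ (Pi.single i k) * z i ^ k) (θ z) := by
  refine ((hasSum_single_iff hθ (F := fun α x => x * mon z α) (fun α => zero_mul _)).2
    (hasSum_coeff θ hz)).congr_fun fun k => ?_
  rw [mon_single]

theorem dependsOnlyOn_of_backShift {i : Fin n} {θ : HardySpace n}
    (hθ : ∀ j, j ≠ i → backShift j θ = 0) : DependsOnlyOn (θ : (Fin n → ℂ) → ℂ) i := by
  intro z hz w hw h
  have h1 := hasSum_pow hθ hz
  rw [h] at h1
  exact h1.unique (hasSum_pow hθ hw)

/-- A function of `z_i` of norm `1` that is bounded by `1` is inner: its radial limits are bounded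
by `1` and have mean square `1`. -/
theorem isInner_of_norm_le_one {i : Fin n} {θ : HardySpace n} (h1 : ‖θ‖ = 1)
    (hθ : ∀ j, j ≠ i → backShift j θ = 0) (hb : ∀ z ∈ polydisc n, ‖θ z‖ ≤ 1) :
    IsInner (θ : (Fin n → ℂ) → ℂ) := by
  refine ⟨θ.2.1, ⟨1, hb⟩, ?_⟩
  have hs : HasSum (fun k : ℕ => ‖coeff θ (Pi.single i k)‖ ^ 2) 1 := by
    have h := hasSum_norm_sq θ
    rw [h1, one_pow] at h
    exact (hasSum_single_iff hθ (F := fun _ x => ‖x‖ ^ 2) (by simp)).2 h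
  obtain ⟨φ, hφ, hφn, hφl⟩ := exists_radial_limit hs.summable
  rw [hs.tsum_eq] at hφn
  have hpt : ∀ r : ℝ, 0 ≤ r → r < 1 → ∀ t : UnitAddTorus (Fin n),
      ∑' k : ℕ, coeff θ (Pi.single i k) * (r * ((t i).toCircle : ℂ)) ^ k =
        θ ((r : ℂ) • torusPoint t) := fun r h0 h1 t =>
    (hasSum_pow hθ (smul_torusPoint_mem h0 h1 t)).tsum_eq
  have hle : ∀ᵐ t ∂AddCircle.haarAddCircle, ‖φ t‖ ≤ 1 := by
    filter_upwards [hφl] with t ht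
    refine le_of_tendsto ht.norm ?_
    filter_upwards [Ico_mem_nhdsLT (zero_lt_one (α := ℝ))] with r ⟨hr0, hr1⟩
    have := hpt r hr0 hr1 fun _ => t
    rw [this]
    exact hb _ (smul_torusPoint_mem hr0 hr1 _)
  have heq : ∀ᵐ t ∂AddCircle.haarAddCircle, ‖φ t‖ = 1 := by
    have hi : Integrable (fun t => ‖φ t‖ ^ 2) AddCircle.haarAddCircle := hφ.integrable_norm_pow'
    have hz : ∫ t, (1 - ‖φ t‖ ^ 2) ∂AddCircle.haarAddCircle = 0 := by
      rw [integral_sub (integrable_const _) hi, hφn]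
      simp
    have h0 : 0 ≤ᵐ[AddCircle.haarAddCircle] fun t => 1 - ‖φ t‖ ^ 2 := by
      filter_upwards [hle] with t ht
      have := pow_le_one₀ (n := 2) (norm_nonneg (φ t)) ht
      simpa using this
    filter_upwards [(integral_eq_zero_iff_of_nonneg_ae h0 ((integrable_const _).sub hi)).1 hz]
      with t ht
    have h2 : ‖φ t‖ ^ 2 = 1 := by
      have : 1 - ‖φ t‖ ^ 2 = 0 := ht
      linarith
    exact (pow_eq_one_iff_of_nonneg (norm_nonneg _) two_ne_zero).1 h2
  have hq : Measure.QuasiMeasurePreserving (fun t : UnitAddTorus (Fin n) => t i) (torusMeasure n)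
      AddCircle.haarAddCircle := Measure.quasiMeasurePreserving_eval _ i
  filter_upwards [hq.ae hφl, hq.ae heq] with t ht1 ht2
  refine ⟨φ (t i), ht2, ht1.congr' ?_⟩
  filter_upwards [Ico_mem_nhdsLT (zero_lt_one (α := ℝ))] with r ⟨hr0, hr1⟩
  exact hpt r hr0 hr1 t

/-! ### The operator identity -/

namespace ShiftSubmodule

variable (S : ShiftSubmodule n)

theorem coe_R (j : Fin n) (f : S.toSubmodule) : (S.R j f : HardySpace n) = shift j f := rfl

theorem adjoint_R_R (j : Fin n) (f : S.toSubmodule) :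
    ContinuousLinearMap.adjoint (S.R j) (S.R j f) = f :=
  ext_inner_left ℂ fun g => by
    rw [ContinuousLinearMap.adjoint_inner_right, Submodule.coe_inner, Submodule.coe_inner, coe_R,
      coe_R, inner_shift_shift]

theorem adjoint_E (j : Fin n) (f : S.toSubmodule) :
    ContinuousLinearMap.adjoint (S.E j) f = evalZero j (f : HardySpace n) :=
  ext_inner_left ℂ fun g => by
    rw [ContinuousLinearMap.adjoint_inner_right, E, ContinuousLinearMap.comp_apply,
      Submodule.inner_orthogonalProjectionOnto_eq_of_mem_right, ← adjoint_evalZero,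
      ContinuousLinearMap.adjoint_inner_right, adjoint_evalZero]

/-- The operator `I - E E^*` annihilates exactly the functions that do not depend on `z_j`. -/
theorem sub_E_apply_eq_zero_iff (j : Fin n) (g : S.toSubmodule) :
    g - S.E j (ContinuousLinearMap.adjoint (S.E j) g) = 0 ↔
      backShift j (g : HardySpace n) = 0 := by
  constructor
  · intro h
    have h1 : inner ℂ g g = inner ℂ g (S.E j (ContinuousLinearMap.adjoint (S.E j) g)) := by
      rw [← sub_eq_zero.1 h]
    rw [← ContinuousLinearMap.adjoint_inner_left, adjoint_E, Submodule.coe_inner,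
      inner_self_eq_norm_sq_to_K, inner_self_eq_norm_sq_to_K] at h1
    have h2 : ‖(g : HardySpace n)‖ ^ 2 = ‖evalZero j (g : HardySpace n)‖ ^ 2 :=
      Complex.ofReal_injective (by simpa using h1)
    have h3 := norm_sq_eq_evalZero_add j (g : HardySpace n)
    rw [h2, left_eq_add] at h3
    simpa using h3
  · intro h
    have h1 : evalZero j (g : HardySpace n) = g := by rw [evalZero_eq, h, map_zero, sub_zero]
    rw [adjoint_E, E, ContinuousLinearMap.comp_apply, h1, h1,
      Submodule.orthogonalProjectionOnto_mem_subspace_eq_self, sub_self]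

/-- The operator identity says that `S ⊖ z_j S` consists of functions that do not depend
on `z_j`. -/
theorem comp_eq_zero_iff (j : Fin n) :
    (ContinuousLinearMap.id ℂ S.toSubmodule -
        (S.E j).comp (ContinuousLinearMap.adjoint (S.E j))).comp
      (ContinuousLinearMap.id ℂ S.toSubmodule -
        (S.R j).comp (ContinuousLinearMap.adjoint (S.R j))) = 0 ↔
    ∀ g : S.toSubmodule, (∀ f : S.toSubmodule, inner ℂ (g : HardySpace n) (shift j f) = 0) →
      backShift j (g : HardySpace n) = 0 := by
  constructor
  · intro h g hg
    have h0 : ContinuousLinearMap.adjoint (S.R j) g = 0 := ext_inner_right ℂ fun f => by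
      rw [ContinuousLinearMap.adjoint_inner_left, inner_zero_left, Submodule.coe_inner, coe_R, hg]
    have h1 := DFunLike.congr_fun h g
    simp only [ContinuousLinearMap.comp_apply, _root_.sub_apply,
      ContinuousLinearMap.id_apply, h0, map_zero, sub_zero, _root_.zero_apply] at h1
    exact (S.sub_E_apply_eq_zero_iff j g).1 h1
  · intro h
    ext1 f
    refine (S.sub_E_apply_eq_zero_iff j _).2 (h _ fun u => ?_)
    have h1 : inner ℂ (f - S.R j (ContinuousLinearMap.adjoint (S.R j) f)) (S.R j u) = 0 := by
      rw [← ContinuousLinearMap.adjoint_inner_left, map_sub, adjoint_R_R, sub_self,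
        inner_zero_left]
    exact h1

/-- If `S ⊖ z_j S` consists of functions that do not depend on `z_j`, then `S` reduces
`M_{z_j}`. -/
theorem backShift_mem {j : Fin n}
    (h : ∀ g : S.toSubmodule, (∀ f : S.toSubmodule, inner ℂ (g : HardySpace n) (shift j f) = 0) →
      backShift j (g : HardySpace n) = 0) {f : HardySpace n} (hf : f ∈ S.toSubmodule) :
    backShift j f ∈ S.toSubmodule := by
  let u := ContinuousLinearMap.adjoint (S.R j) ⟨f, hf⟩
  have h1 := h (⟨f, hf⟩ - S.R j u) fun v => by
    have : inner ℂ ((⟨f, hf⟩ : S.toSubmodule) - S.R j u) (S.R j v) = 0 := by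
      rw [← ContinuousLinearMap.adjoint_inner_left, map_sub, adjoint_R_R, sub_self,
        inner_zero_left]
    exact this
  rw [Submodule.coe_sub, map_sub, coe_R, backShift_shift, sub_eq_zero] at h1
  rw [h1]
  exact u.2

end ShiftSubmodule

/-- If `S = θ H²` with `θ` depending on `z_i` only, then `S ⊖ z_j S` consists of functions that do
not depend on `z_j`, for `j ≠ i`. -/
theorem backShift_eq_zero_of_mulHardy {S : ShiftSubmodule n} {i j : Fin n} (hj : j ≠ i)
    {θ : (Fin n → ℂ) → ℂ} (hθ : DependsOnlyOn θ i)
    (hS : (fun f : HardySpace n => (f : (Fin n → ℂ) → ℂ)) ''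
      (S.toSubmodule : Set (HardySpace n)) = mulHardy θ) {g : HardySpace n}
    (hg : g ∈ S.toSubmodule) (hgo : ∀ f ∈ S.toSubmodule, inner ℂ g (shift j f) = 0) :
    backShift j g = 0 := by
  obtain ⟨u, hu⟩ : (g : (Fin n → ℂ) → ℂ) ∈ mulHardy θ := hS ▸ ⟨g, hg, rfl⟩
  obtain ⟨v, hv, hv'⟩ : (fun z => θ z * (backShift j u) z) ∈
      (fun f : HardySpace n => (f : (Fin n → ℂ) → ℂ)) '' (S.toSubmodule : Set (HardySpace n)) :=
    hS ▸ ⟨backShift j u, rfl⟩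
  -- Since `θ` does not depend on `z_j`, evaluation at `z_j = 0` commutes with `θ`.
  have h1 : g - evalZero j g = shift j v := HardySpace.ext fun z hz => by
    have hw := update_mem_polydisc j hz
    have h2 : θ (Function.update z j 0) = θ z := hθ _ hw _ hz (by simp [hj.symm])
    have h3 : u z - u (Function.update z j 0) = z j * (backShift j u) z := by
      rw [← evalZero_apply j u hz, ← coe_sub_apply, evalZero_eq, sub_sub_cancel, shift_apply]
    rw [coe_sub_apply, evalZero_apply j g hz, shift_apply, congrFun hu, congrFun hu, h2,
      show v z = θ z * (backShift j u) z from congrFun hv' z, ← mul_sub, h3]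
    ring
  have h2 : g - evalZero j g = shift j (backShift j g) := by rw [evalZero_eq, sub_sub_cancel]
  have h3 := hgo v hv
  rwa [← h1, h2, ← ContinuousLinearMap.adjoint_inner_left, inner_self_eq_zero] at h3

end PolydiscHardy

end

theorem mainTheorem2 (n : ℕ) (i : Fin n) (S : PolydiscHardy.ShiftSubmodule n)
    (hS : S.toSubmodule ≠ ⊥) :
    (∃ θ : (Fin n → ℂ) → ℂ, PolydiscHardy.IsInner θ ∧ PolydiscHardy.DependsOnlyOn θ i ∧
      (fun f : PolydiscHardy.HardySpace n => (f : (Fin n → ℂ) → ℂ)) ''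
        (S.toSubmodule : Set (PolydiscHardy.HardySpace n)) = PolydiscHardy.mulHardy θ) ↔
    ∀ j : Fin n, j ≠ i →
      (ContinuousLinearMap.id ℂ S.toSubmodule -
          (S.E j).comp (ContinuousLinearMap.adjoint (S.E j))).comp
        (ContinuousLinearMap.id ℂ S.toSubmodule -
          (S.R j).comp (ContinuousLinearMap.adjoint (S.R j))) = 0 := by
  constructor
  · rintro ⟨θ, -, hθ, h⟩ j hj
    exact (S.comp_eq_zero_iff j).2 fun g hg =>
      PolydiscHardy.backShift_eq_zero_of_mulHardy hj hθ h g.2 fun f hf => hg ⟨f, hf⟩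
  · intro h
    obtain ⟨θ, h1, hθ, V, hV, hVS⟩ := PolydiscHardy.exists_generator (i := i) S.isClosed'
      S.shift_mem' (fun j hj f hf => S.backShift_mem ((S.comp_eq_zero_iff j).1 (h j hj)) hf) hS
    refine ⟨θ, PolydiscHardy.isInner_of_norm_le_one h1 hθ fun z hz =>
      PolydiscHardy.norm_apply_le_one hV hz, PolydiscHardy.dependsOnlyOn_of_backShift hθ, ?_⟩
    have hfun : ∀ g, (V g : (Fin n → ℂ) → ℂ) = fun z => θ z * g z := fun g => funext fun z => by
      by_cases hz : z ∈ PolydiscHardy.polydisc n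
      · exact hV g z hz
      · rw [(V g).2.2.1 z hz, g.2.2.1 z hz, mul_zero]
    ext F
    constructor
    · rintro ⟨f, hf, rfl⟩
      obtain ⟨g, rfl⟩ := (hVS f).1 hf
      exact ⟨g, hfun g⟩
    · rintro ⟨g, rfl⟩
      exact ⟨V g, (hVS _).2 ⟨g, rfl⟩, hfun g⟩
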